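/- Let $D$ be a connected open subset of the half-plane $\{(z,\rho):\rho>0\}$, and let $\mathcal E,\Phi:D\to\mathbb C$ be smooth with $f:=\Re\mathcal E+|\Phi|^2\neq 0$ on $D$, satisfying the Ernst equations $$f\,\nabla^2\mathcal E=(\nabla\mathcal E+2\Phi^*\nabla\Phi)\cdot\nabla\mathcal E,\qquad f\,\nabla^2\Phi=(\nabla\mathcal E+2\Phi^*\nabla\Phi)\cdot\nabla\Phi,$$ where $\nabla^2=\partial_z^2+\partial_\rho^2+\rho^{-1}\partial_\rho$, $\nabla A\cdot\nabla B=A_{,z}B_{,z}+A_{,\rho}B_{,\rho}$ and ${}^*$ is complex conjugation. Let $\omega,\gamma:D\to\mathbb R$ be differentiable functions obtained from them by $$\omega_{,z}=-\rho f^{-2}[\chi_{,\rho}+2\Im(\Phi^*\Phi_{,\rho})],\qquad \omega_{,\rho}=\rho f^{-2}[\chi_{,z}+2\Im(\Phi^*\Phi_{,z})],\qquad \chi=\Im\mathcal E,$$ $$\gamma_{,z}=\tfrac14\rho f^{-2}(G_\rho G_z^*+G_zG_\rho^*)-\rho f^{-1}(\Phi_{,\rho}\Phi_{,z}^*+\Phi_{,z}\Phi_{,\rho}^*),$$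 $$\gamma_{,\rho}=\tfrac14\rho f^{-2}(G_\rho G_\rho^*-G_zG_z^*)-\rho f^{-1}(\Phi_{,\rho}\Phi_{,\rho}^*-\Phi_{,z}\Phi_{,z}^*),$$ with $G_z=\mathcal E_{,z}+2\Phi^*\Phi_{,z}$ and $G_\rho=\mathcal E_{,\rho}+2\Phi^*\Phi_{,\rho}$; these are the metric functions of the line element $ds^2=f^{-1}[e^{2\gamma}(dz^2+d\rho^2)+\rho^2d\varphi^2]-f(dt-\omega\,d\varphi)^2$. The potentials of a given metric are fixed only up to the additive constants $a\in\mathbb C$, $b\in\mathbb R$ of the transformations $$\Phi\mapsto\Phi+a,\qquad \mathcal E\mapsto\mathcal E-2a^*\Phi-|a|^2+ib,$$ which change neither $f$ nor the equations for $\omega$ and $\gamma$. For every choice of the origin of $z$ the following hold. (Each condition below includes that $D$ is invariant under $z\to-z$; the metric is called equatorially symmetric, respectively antisymmetric, if the left-hand condition of 1, respectively 2, holds for some choice of the origin.) 1. $f$, $\omega$, $\gamma$ are all even functions of $z$ if and only if, for a suitable choice of the additive constants of the potentials, there is a real constant $\delta$ such that on $D$ $$\mathcal E(-z,\rho)=\mathcal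 E(z,\rho)^*,\qquad \Phi(-z,\rho)=e^{2i\delta}\,\Phi(z,\rho)^*.$$ 2. $f$ and $\gamma$ are even and $\omega-\omega_0$ is odd in $z$ for some real constant $\omega_0$ if and only if, for a suitable choice of the additive constants of the potentials, on $D$ $$\mathcal E(-z,\rho)=\mathcal E(z,\rho),\qquad \Phi(-z,\rho)=\pm\Phi(z,\rho)$$ (with one sign on all of $D$). 3. If the additive constants are already fixed by $\Phi=0$ and $\Im\mathcal E=0$ at some point of $D$ with $z=0$, or by $\Phi\to0$ and $\Im\mathcal E\to0$ at infinity in an unbounded $D$, then 1 and 2 hold for $\mathcal E$ and $\Phi$ themselves, without any change of the additive constants. -/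

import Mathlib

open Filter Topology
open scoped ComplexConjugate

noncomputable section

namespace Ernst

/-- The partial derivative with respect to the first coordinate `z` of a function of `(z, ρ)`. -/
def dz {F : Type*} [NormedAddCommGroup F] [NormedSpace ℝ F] (A : ℝ × ℝ → F) (p : ℝ × ℝ) : F :=
  fderiv ℝ A p (1, 0)

/-- The partial derivative with respect to the second coordinate `ρ` of a function of `(z, ρ)`. -/
def dρ {F : Type*} [NormedAddCommGroup F] [NormedSpace ℝ F] (A : ℝ × ℝ → F) (p : ℝ × ℝ) : F :=
  fderiv ℝ A p (0, 1)

/-- The Laplacian of flat three-dimensional space, on axisymmetric functions, in cylindrical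
coordinates. -/
def laplacian (A : ℝ × ℝ → ℂ) (p : ℝ × ℝ) : ℂ :=
  dz (dz A) p + dρ (dρ A) p + ((p.2 : ℂ))⁻¹ * dρ A p

/-- The metric function `f = Re E + |Φ|²`. -/
def metricF (E Φ : ℝ × ℝ → ℂ) (p : ℝ × ℝ) : ℝ := (E p).re + ‖Φ p‖ ^ 2

/-- The `z`-component of `∇E + 2 Φ* ∇Φ`. -/
def Gz (E Φ : ℝ × ℝ → ℂ) (p : ℝ × ℝ) : ℂ := dz E p + 2 * conj (Φ p) * dz Φ p

/-- The `ρ`-component of `∇E + 2 Φ* ∇Φ`. -/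
def Gρ (E Φ : ℝ × ℝ → ℂ) (p : ℝ × ℝ) : ℂ := dρ E p + 2 * conj (Φ p) * dρ Φ p

/-- A stationary axisymmetric electrovac solution on a domain `D` of the half-plane `ρ > 0`:
smooth Ernst potentials `E`, `Φ` with `f ≠ 0` that solve the Ernst equations, together with
metric functions `ω`, `γ` obtained from them by integrating the usual first-order equations, so that
the line element is `f⁻¹ (e^{2γ} (dz² + dρ²) + ρ² dφ²) - f (dt - ω dφ)²`. -/
structure IsElectrovacSolution (D : Set (ℝ × ℝ)) (E Φ : ℝ × ℝ → ℂ) (ω γ : ℝ × ℝ → ℝ) :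
    Prop where
  isOpen : IsOpen D
  isConnected : IsConnected D
  rho_pos : ∀ p ∈ D, 0 < p.2
  smooth_E : ContDiffOn ℝ (⊤ : ℕ∞) E D
  smooth_Φ : ContDiffOn ℝ (⊤ : ℕ∞) Φ D
  f_ne_zero : ∀ p ∈ D, metricF E Φ p ≠ 0
  ernst_E : ∀ p ∈ D, (metricF E Φ p : ℂ) * laplacian E p
    = Gz E Φ p * dz E p + Gρ E Φ p * dρ E p
  ernst_Φ : ∀ p ∈ D, (metricF E Φ p : ℂ) * laplacian Φ p
    = Gz E Φ p * dz Φ p + Gρ E Φ p * dρ Φ p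
  differentiable_ω : DifferentiableOn ℝ ω D
  differentiable_γ : DifferentiableOn ℝ γ D
  ω_z : ∀ p ∈ D, dz ω p = -(p.2 * (metricF E Φ p ^ 2)⁻¹ *
    (dρ (fun q => (E q).im) p + 2 * (conj (Φ p) * dρ Φ p).im))
  ω_ρ : ∀ p ∈ D, dρ ω p = p.2 * (metricF E Φ p ^ 2)⁻¹ *
    (dz (fun q => (E q).im) p + 2 * (conj (Φ p) * dz Φ p).im)
  γ_z : ∀ p ∈ D, ((dz γ p : ℝ) : ℂ) =
    1 / 4 * (p.2 : ℂ) * ((metricF E Φ p : ℂ) ^ 2)⁻¹ *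
      (Gρ E Φ p * conj (Gz E Φ p) + Gz E Φ p * conj (Gρ E Φ p))
    - (p.2 : ℂ) * (metricF E Φ p : ℂ)⁻¹ *
      (dρ Φ p * conj (dz Φ p) + dz Φ p * conj (dρ Φ p))
  γ_ρ : ∀ p ∈ D, ((dρ γ p : ℝ) : ℂ) =
    1 / 4 * (p.2 : ℂ) * ((metricF E Φ p : ℂ) ^ 2)⁻¹ *
      (Gρ E Φ p * conj (Gρ E Φ p) - Gz E Φ p * conj (Gz E Φ p))
    - (p.2 : ℂ) * (metricF E Φ p : ℂ)⁻¹ *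
      (dρ Φ p * conj (dρ Φ p) - dz Φ p * conj (dz Φ p))

/-- The reflection at the plane `z = z₀`; it is `(z, ρ) ↦ (-z, ρ)` when the origin of `z` is
put at `z₀`. -/
def reflect (z₀ : ℝ) (p : ℝ × ℝ) : ℝ × ℝ := (2 * z₀ - p.1, p.2)

/-- The metric functions `f`, `ω`, `γ` on `D` are even in `z` when the origin is put at `z₀`.
A spacetime is equatorially symmetric when this holds for some `z₀`. -/
def EquatoriallySymmetricAt (D : Set (ℝ × ℝ)) (f ω γ : ℝ × ℝ → ℝ) (z₀ : ℝ) : Prop :=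
  ∀ p ∈ D, reflect z₀ p ∈ D ∧ f (reflect z₀ p) = f p ∧ ω (reflect z₀ p) = ω p ∧
    γ (reflect z₀ p) = γ p

/-- The metric functions `f`, `γ` on `D` are even in `z`, and `ω - ω₀` is odd for some constant
`ω₀`, when the origin is put at `z₀`. A spacetime is equatorially antisymmetric when this holds
for some `z₀`. -/
def EquatoriallyAntisymmetricAt (D : Set (ℝ × ℝ)) (f ω γ : ℝ × ℝ → ℝ) (z₀ : ℝ) : Prop :=
  ∃ ω₀ : ℝ, ∀ p ∈ D, reflect z₀ p ∈ D ∧ f (reflect z₀ p) = f p ∧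
    ω (reflect z₀ p) - ω₀ = -(ω p - ω₀) ∧ γ (reflect z₀ p) = γ p

/-- `E(-z, ρ) = E(z, ρ)*` and `Φ(-z, ρ) = e^{2iδ} Φ(z, ρ)*` on `D`, for a real constant `δ`, when
the origin is put at `z₀`. -/
def PotentialsSymmetricAt (D : Set (ℝ × ℝ)) (E Φ : ℝ × ℝ → ℂ) (z₀ : ℝ) : Prop :=
  ∃ δ : ℝ, ∀ p ∈ D, reflect z₀ p ∈ D ∧ E (reflect z₀ p) = conj (E p) ∧
    Φ (reflect z₀ p) = Complex.exp (2 * Complex.I * δ) * conj (Φ p)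

/-- `E(-z, ρ) = E(z, ρ)` and `Φ(-z, ρ) = ± Φ(z, ρ)` on `D`, with one sign on all of `D`, when the
origin is put at `z₀`. -/
def PotentialsAntisymmetricAt (D : Set (ℝ × ℝ)) (E Φ : ℝ × ℝ → ℂ) (z₀ : ℝ) : Prop :=
  ∃ ε : ℂ, (ε = 1 ∨ ε = -1) ∧ ∀ p ∈ D, reflect z₀ p ∈ D ∧ E (reflect z₀ p) = E p ∧
    Φ (reflect z₀ p) = ε * Φ p

/-- The electromagnetic potential after the change of additive constants `(a, b)`. -/
def gaugeΦ (a : ℂ) (Φ : ℝ × ℝ → ℂ) (p : ℝ × ℝ) : ℂ := Φ p + a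

/-- The gravitational potential after the change of additive constants `(a, b)`, which leaves
`f` and `∇E + 2 Φ* ∇Φ` unchanged. -/
def gaugeE (a : ℂ) (b : ℝ) (E Φ : ℝ × ℝ → ℂ) (p : ℝ × ℝ) : ℂ :=
  E p - 2 * conj a * Φ p - (‖a‖ : ℂ) ^ 2 + b * Complex.I

/-- The additive constants of the potentials are fixed by `Φ = 0`, `Im E = 0`, either at a
point of `D` on the plane `z = z₀` or at infinity in an unbounded `D`. -/
def NormalizedAt (D : Set (ℝ × ℝ)) (E Φ : ℝ × ℝ → ℂ) (z₀ : ℝ) : Prop :=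
  (∃ p ∈ D, p.1 = z₀ ∧ Φ p = 0 ∧ (E p).im = 0) ∨
  (¬ Bornology.IsBounded D ∧
    Tendsto Φ (Bornology.cobounded (ℝ × ℝ) ⊓ 𝓟 D) (𝓝 0) ∧
    Tendsto (fun p => (E p).im) (Bornology.cobounded (ℝ × ℝ) ⊓ 𝓟 D) (𝓝 0))

end Ernst

end

/-! The metric determines its potentials up to the additive constants and one constant phase of Φ
(`exists_gauge_of_same_metric`). Write R for the reflection. Composing the potentials with R turns
ω, γ into -ω∘R, γ∘R (`comp_reflect`), and conjugating them turns ω into -ω (`conjugate`). If the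
metric is symmetric, the reflected and the conjugated solution have the same metric; if it is
antisymmetric, the reflected solution has the original metric up to a constant in ω. So the
reflected potentials are E*, Φ* or E, Φ up to constants and a phase u. A normalization makes the
constants vanish, and in the antisymmetric case reflecting twice gives u² = 1 unless Φ vanishes
identically. Conversely, the potentials fix ω and γ up to constants (`exists_const_of_eqOn`), which
are controlled at a point of D fixed by R.

Why the metric determines the potentials: G = ∇E + 2Φ*∇Φ has real part ∇f, and its imaginary part is
read off ∇ω. The divergence of G then gives |∇Φ|², its curl gives Im(Φ_z Φ_ρ*), and ∇γ gives the
remaining entries of the Gram matrix of ∇Φ (`gram_eq`). Hence ∇Φ₁ = U∇Φ₂ with |U| = 1 wherever ∇Φ₂ ≠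
0, and equality of mixed derivatives together with the Ernst equation makes U locally constant
(`exists_local_phase`).

Zeros of ∇Φ₂ might separate regions with different phases. This is excluded by unique continuation:
Ψ = Φ₁ - uΦ₂ solves the linear equation f∇²Ψ = G·∇Ψ, and its gradient vanishes on an open set. Since
only derivatives of Ψ occur in the equation, a Carleman inequality for ∂̄ applied to ∂Ψ, with a
Gaussian in the exponent of the weight, propagates the vanishing through D. -/

noncomputable section

namespace Ernst

open MeasureTheory

/-! ### Calculus of the two partial derivatives -/

section Calculus

variable {F : Type*} [NormedAddCommGroup F] [NormedSpace ℝ F]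
  {𝔸 : Type*} [NormedCommRing 𝔸] [NormedAlgebra ℝ 𝔸] {p : ℝ × ℝ}

theorem _root_.HasFDerivAt.dz {A : ℝ × ℝ → F} {A' : ℝ × ℝ →L[ℝ] F} (h : HasFDerivAt A A' p) :
    Ernst.dz A p = A' (1, 0) := by
  rw [Ernst.dz, h.fderiv]

theorem _root_.HasFDerivAt.dρ {A : ℝ × ℝ → F} {A' : ℝ × ℝ →L[ℝ] F} (h : HasFDerivAt A A' p) :
    Ernst.dρ A p = A' (0, 1) := by
  rw [Ernst.dρ, h.fderiv]

theorem dz_const (c : F) : dz (fun _ => c) p = 0 := (hasFDerivAt_const c p).dz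

theorem dρ_const (c : F) : dρ (fun _ => c) p = 0 := (hasFDerivAt_const c p).dρ

theorem dz_congr {A B : ℝ × ℝ → F} (h : A =ᶠ[𝓝 p] B) : dz A p = dz B p := by
  rw [dz, dz, h.fderiv_eq]

theorem dρ_congr {A B : ℝ × ℝ → F} (h : A =ᶠ[𝓝 p] B) : dρ A p = dρ B p := by
  rw [dρ, dρ, h.fderiv_eq]

theorem dz_add {A B : ℝ × ℝ → F} (hA : DifferentiableAt ℝ A p) (hB : DifferentiableAt ℝ B p) :
    dz (fun q => A q + B q) p = dz A p + dz B p :=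
  (hA.hasFDerivAt.add hB.hasFDerivAt).dz

theorem dρ_add {A B : ℝ × ℝ → F} (hA : DifferentiableAt ℝ A p) (hB : DifferentiableAt ℝ B p) :
    dρ (fun q => A q + B q) p = dρ A p + dρ B p :=
  (hA.hasFDerivAt.add hB.hasFDerivAt).dρ

theorem dz_sub {A B : ℝ × ℝ → F} (hA : DifferentiableAt ℝ A p) (hB : DifferentiableAt ℝ B p) :
    dz (fun q => A q - B q) p = dz A p - dz B p :=
  (hA.hasFDerivAt.sub hB.hasFDerivAt).dz

theorem dρ_sub {A B : ℝ × ℝ → F} (hA : DifferentiableAt ℝ A p) (hB : DifferentiableAt ℝ B p) :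
    dρ (fun q => A q - B q) p = dρ A p - dρ B p :=
  (hA.hasFDerivAt.sub hB.hasFDerivAt).dρ

theorem dz_neg (A : ℝ × ℝ → F) : dz (fun q => -A q) p = -dz A p := by
  simp only [dz, fderiv_fun_neg, neg_apply]

theorem dρ_neg (A : ℝ × ℝ → F) : dρ (fun q => -A q) p = -dρ A p := by
  simp only [dρ, fderiv_fun_neg, neg_apply]

theorem dz_mul {A B : ℝ × ℝ → 𝔸} (hA : DifferentiableAt ℝ A p) (hB : DifferentiableAt ℝ B p) :
    dz (fun q => A q * B q) p = A p * dz B p + dz A p * B p := by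
  refine (hA.hasFDerivAt.mul hB.hasFDerivAt).dz.trans ?_
  simp [dz, mul_comm]

theorem dρ_mul {A B : ℝ × ℝ → 𝔸} (hA : DifferentiableAt ℝ A p) (hB : DifferentiableAt ℝ B p) :
    dρ (fun q => A q * B q) p = A p * dρ B p + dρ A p * B p := by
  refine (hA.hasFDerivAt.mul hB.hasFDerivAt).dρ.trans ?_
  simp [dρ, mul_comm]

theorem dz_const_mul {A : ℝ × ℝ → 𝔸} (c : 𝔸) (hA : DifferentiableAt ℝ A p) :
    dz (fun q => c * A q) p = c * dz A p := by
  simp [dz_mul (differentiableAt_const c) hA, dz_const]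

theorem dρ_const_mul {A : ℝ × ℝ → 𝔸} (c : 𝔸) (hA : DifferentiableAt ℝ A p) :
    dρ (fun q => c * A q) p = c * dρ A p := by
  simp [dρ_mul (differentiableAt_const c) hA, dρ_const]

theorem dz_clm (L : F →L[ℝ] 𝔸) {A : ℝ × ℝ → F} (hA : DifferentiableAt ℝ A p) :
    dz (fun q => L (A q)) p = L (dz A p) :=
  (L.hasFDerivAt.comp p hA.hasFDerivAt).dz

theorem dρ_clm (L : F →L[ℝ] 𝔸) {A : ℝ × ℝ → F} (hA : DifferentiableAt ℝ A p) :
    dρ (fun q => L (A q)) p = L (dρ A p) :=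
  (L.hasFDerivAt.comp p hA.hasFDerivAt).dρ

theorem dz_exp {A : ℝ × ℝ → ℝ} (hA : DifferentiableAt ℝ A p) :
    dz (fun q => Real.exp (A q)) p = Real.exp (A p) * dz A p := by
  rw [hA.hasFDerivAt.exp.dz]; rfl

theorem dρ_exp {A : ℝ × ℝ → ℝ} (hA : DifferentiableAt ℝ A p) :
    dρ (fun q => Real.exp (A q)) p = Real.exp (A p) * dρ A p := by
  rw [hA.hasFDerivAt.exp.dρ]; rfl

theorem fderiv_eq_zero_of_dz_of_dρ {A : ℝ × ℝ → F} (h1 : dz A p = 0) (h2 : dρ A p = 0) :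
    fderiv ℝ A p = 0 := by
  ext <;> simpa using by assumption

theorem contDiffAt_dz {A : ℝ × ℝ → F} (h : ContDiffAt ℝ (⊤ : ℕ∞) A p) :
    ContDiffAt ℝ (⊤ : ℕ∞) (dz A) p :=
  (h.fderiv_right (m := (⊤ : ℕ∞)) (by simp)).clm_apply contDiffAt_const

theorem contDiffAt_dρ {A : ℝ × ℝ → F} (h : ContDiffAt ℝ (⊤ : ℕ∞) A p) :
    ContDiffAt ℝ (⊤ : ℕ∞) (dρ A) p :=
  (h.fderiv_right (m := (⊤ : ℕ∞)) (by simp)).clm_apply contDiffAt_const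

theorem contDiff_dz {A : ℝ × ℝ → F} (h : ContDiff ℝ (⊤ : ℕ∞) A) :
    ContDiff ℝ (⊤ : ℕ∞) (dz A) :=
  contDiff_iff_contDiffAt.2 fun _ => contDiffAt_dz h.contDiffAt

theorem contDiff_dρ {A : ℝ × ℝ → F} (h : ContDiff ℝ (⊤ : ℕ∞) A) :
    ContDiff ℝ (⊤ : ℕ∞) (dρ A) :=
  contDiff_iff_contDiffAt.2 fun _ => contDiffAt_dρ h.contDiffAt

theorem dρ_dz_comm {A : ℝ × ℝ → F} (h : ContDiffAt ℝ (⊤ : ℕ∞) A p) :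
    dρ (dz A) p = dz (dρ A) p := by
  have hd : DifferentiableAt ℝ (fderiv ℝ A) p :=
    (h.fderiv_right (m := (⊤ : ℕ∞)) (by simp)).differentiableAt (by simp)
  have key : ∀ v w : ℝ × ℝ, fderiv ℝ (fun q => fderiv ℝ A q v) p w
      = fderiv ℝ (fderiv ℝ A) p w v := fun v w => by
    rw [(hd.hasFDerivAt.clm_apply (hasFDerivAt_const v p)).fderiv]
    simp
  have hs : IsSymmSndFDerivAt ℝ A p :=
    h.isSymmSndFDerivAt (by
      rw [minSmoothness_of_isRCLikeNormedField]
      exact WithTop.coe_le_coe.2 le_top)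
  exact (key _ _).trans ((hs _ _).trans (key _ _).symm)

end Calculus

/-! ### The Carleman inequality for ∂̄ -/

theorem dz_eq_zero_of_notMem_tsupport {A : ℝ × ℝ → ℝ} {p : ℝ × ℝ} (h : p ∉ tsupport A) : dz A p = 0 := by
  rw [dz_congr (notMem_tsupport_iff_eventuallyEq.1 h)]
  exact dz_const _

theorem dρ_eq_zero_of_notMem_tsupport {A : ℝ × ℝ → ℝ} {p : ℝ × ℝ} (h : p ∉ tsupport A) : dρ A p = 0 := by
  rw [dρ_congr (notMem_tsupport_iff_eventuallyEq.1 h)]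
  exact dρ_const _

theorem integral_fderiv_apply_eq_zero {X : ℝ × ℝ → ℝ} (hX : ContDiff ℝ 1 X)
    (hc : HasCompactSupport X) (v : ℝ × ℝ) : ∫ p, fderiv ℝ X p v = 0 := by
  have h1 : Integrable (fun p => fderiv ℝ X p v) :=
    ((hX.continuous_fderiv (by simp)).clm_apply continuous_const).integrable_of_hasCompactSupport
      (hc.fderiv_apply ℝ v)
  have := integral_mul_fderiv_eq_neg_fderiv_mul_of_integrable (μ := (volume : Measure (ℝ × ℝ)))
    (f := fun _ => (1 : ℝ)) (g := X) (v := v) (by simp) (by simpa using h1)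
    (by simpa using hX.continuous.integrable_of_hasCompactSupport hc)
    (fun _ _ => differentiableAt_const _) (fun _ _ => hX.differentiable (by simp) _)
  simpa using this

/-- With w = a + ib and ∂̄ = (∂_z + i∂_ρ)/2, the right-hand integrand is |Lw|² for L = 2∂̄ - 2(∂̄φ),
whose formal adjoint is L* = -2∂ - 2(∂φ). Integration by parts gives ‖Lw‖² - ‖L*w‖² = ⟨[L*, L]w, w⟩.
The commutator is multiplication by 2Δφ, and ‖L*w‖² ≥ 0 is dropped. -/
theorem carleman {φ a b : ℝ × ℝ → ℝ} (hφ : ContDiff ℝ (⊤ : ℕ∞) φ) (ha : ContDiff ℝ (⊤ : ℕ∞) a)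
    (hb : ContDiff ℝ (⊤ : ℕ∞) b) (hac : HasCompactSupport a) (hbc : HasCompactSupport b) :
    ∫ p, 2 * (dz (dz φ) p + dρ (dρ φ) p) * (a p ^ 2 + b p ^ 2) ≤
      ∫ p, ((dz a p - dρ b p - dz φ p * a p + dρ φ p * b p) ^ 2 +
        (dz b p + dρ a p - dz φ p * b p - dρ φ p * a p) ^ 2) := by
  have hφz := contDiff_dz hφ
  have hφρ := contDiff_dρ hφ
  have haz := contDiff_dz ha
  have haρ := contDiff_dρ ha
  have hbz := contDiff_dz hb
  have hbρ := contDiff_dρ hb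
  have hφzz := contDiff_dz hφz
  have hφρρ := contDiff_dρ hφρ
  have dd : ∀ {A : ℝ × ℝ → ℝ}, ContDiff ℝ (⊤ : ℕ∞) A → ∀ p, DifferentiableAt ℝ A p :=
    fun h p => h.differentiable (by simp) p
  -- The field (X, Y) carries the integration by parts: pointwise, |Lw|² - |L*w|² = 2Δφ|w|² + div(X,
  -- Y).
  set X : ℝ × ℝ → ℝ := fun p => 2 * (b p * dρ a p - a p * dρ b p)
    - 2 * (dz φ p * (a p * a p + b p * b p)) with hXdef
  set Y : ℝ × ℝ → ℝ := fun p => 2 * (a p * dz b p - b p * dz a p)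
    - 2 * (dρ φ p * (a p * a p + b p * b p)) with hYdef
  have hX : ContDiff ℝ (⊤ : ℕ∞) X := by fun_prop
  have hY : ContDiff ℝ (⊤ : ℕ∞) Y := by fun_prop
  have hK : IsCompact (tsupport a ∪ tsupport b) := hac.isCompact.union hbc.isCompact
  have hza : ∀ p ∉ tsupport a ∪ tsupport b, a p = 0 ∧ b p = 0 ∧ dz a p = 0 ∧ dρ a p = 0 ∧
      dz b p = 0 ∧ dρ b p = 0 := by
    intro p hp
    have h1 : p ∉ tsupport a := fun h => hp (Or.inl h)
    have h2 : p ∉ tsupport b := fun h => hp (Or.inr h)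
    exact ⟨image_eq_zero_of_notMem_tsupport h1, image_eq_zero_of_notMem_tsupport h2,
      dz_eq_zero_of_notMem_tsupport h1, dρ_eq_zero_of_notMem_tsupport h1, dz_eq_zero_of_notMem_tsupport h2,
      dρ_eq_zero_of_notMem_tsupport h2⟩
  have hXc : HasCompactSupport X := .intro hK fun p hp => by
    obtain ⟨h1, h2, h3, h4, h5, h6⟩ := hza p hp
    simp [hXdef, h1, h2]
  have hYc : HasCompactSupport Y := .intro hK fun p hp => by
    obtain ⟨h1, h2, h3, h4, h5, h6⟩ := hza p hp
    simp [hYdef, h1, h2]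
  have hdX : ∀ p, dz X p = 2 * (b p * dz (dρ a) p + dz b p * dρ a p
      - (a p * dz (dρ b) p + dz a p * dρ b p))
      - 2 * (dz φ p * (2 * a p * dz a p + 2 * b p * dz b p)
        + dz (dz φ) p * (a p * a p + b p * b p)) := by
    intro p
    have := dd hφz p; have := dd ha p; have := dd hb p; have := dd haρ p; have := dd hbρ p
    rw [hXdef, dz_sub (by fun_prop) (by fun_prop), dz_const_mul _ (by fun_prop),
      dz_const_mul _ (by fun_prop), dz_sub (by fun_prop) (by fun_prop),
      dz_mul (by fun_prop) (by fun_prop), dz_mul (by fun_prop) (by fun_prop),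
      dz_mul (by fun_prop) (by fun_prop), dz_add (by fun_prop) (by fun_prop),
      dz_mul (by fun_prop) (by fun_prop), dz_mul (by fun_prop) (by fun_prop)]
    ring
  have hdY : ∀ p, dρ Y p = 2 * (a p * dρ (dz b) p + dρ a p * dz b p
      - (b p * dρ (dz a) p + dρ b p * dz a p))
      - 2 * (dρ φ p * (2 * a p * dρ a p + 2 * b p * dρ b p)
        + dρ (dρ φ) p * (a p * a p + b p * b p)) := by
    intro p
    have := dd hφρ p; have := dd ha p; have := dd hb p; have := dd haz p; have := dd hbz p
    rw [hYdef, dρ_sub (by fun_prop) (by fun_prop), dρ_const_mul _ (by fun_prop),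
      dρ_const_mul _ (by fun_prop), dρ_sub (by fun_prop) (by fun_prop),
      dρ_mul (by fun_prop) (by fun_prop), dρ_mul (by fun_prop) (by fun_prop),
      dρ_mul (by fun_prop) (by fun_prop), dρ_add (by fun_prop) (by fun_prop),
      dρ_mul (by fun_prop) (by fun_prop), dρ_mul (by fun_prop) (by fun_prop)]
    ring
  have hiX : ∫ p, dz X p = 0 := integral_fderiv_apply_eq_zero (hX.of_le (by simp)) hXc _
  have hiY : ∫ p, dρ Y p = 0 := integral_fderiv_apply_eq_zero (hY.of_le (by simp)) hYc _
  have intg : ∀ {A : ℝ × ℝ → ℝ}, Continuous A → (∀ p ∉ tsupport a ∪ tsupport b, A p = 0) →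
      Integrable A := fun h h' => h.integrable_of_hasCompactSupport (.intro hK h')
  have iX : Integrable (dz X) := (contDiff_dz hX).continuous.integrable_of_hasCompactSupport
    (hXc.fderiv_apply ℝ _)
  have iY : Integrable (dρ Y) := (contDiff_dρ hY).continuous.integrable_of_hasCompactSupport
    (hYc.fderiv_apply ℝ _)
  have c1 := hφ.continuous
  have c2 := ha.continuous
  have c3 := hb.continuous
  have c4 := hφz.continuous
  have c5 := hφρ.continuous
  have c6 := haz.continuous
  have c7 := haρ.continuous
  have c8 := hbz.continuous
  have c9 := hbρ.continuous
  have c10 := hφzz.continuous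
  have c11 := hφρρ.continuous
  have i1 : Integrable (fun p => 2 * (dz (dz φ) p + dρ (dρ φ) p) * (a p ^ 2 + b p ^ 2)) :=
    intg (by fun_prop) fun p hp => by
      obtain ⟨h1, h2, -⟩ := hza p hp
      simp [h1, h2]
  have i2 : Integrable (fun p => (dz a p - dρ b p - dz φ p * a p + dρ φ p * b p) ^ 2 +
        (dz b p + dρ a p - dz φ p * b p - dρ φ p * a p) ^ 2) :=
    intg (by fun_prop) fun p hp => by
      obtain ⟨h1, h2, h3, h4, h5, h6⟩ := hza p hp
      simp [h1, h2, h3, h4, h5, h6]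
  calc ∫ p, 2 * (dz (dz φ) p + dρ (dρ φ) p) * (a p ^ 2 + b p ^ 2)
      = ∫ p, (2 * (dz (dz φ) p + dρ (dρ φ) p) * (a p ^ 2 + b p ^ 2) + (dz X p + dρ Y p)) := by
        have h0 : ∫ p, (dz X p + dρ Y p) = 0 := by rw [integral_add iX iY, hiX, hiY, add_zero]
        exact ((integral_add i1 (iX.add iY)).trans ((congrArg _ h0).trans (add_zero _))).symm
    _ ≤ _ := by
        refine integral_mono (i1.add (iX.add iY)) i2 fun p => ?_
        simp only [hdX, hdY, dρ_dz_comm ha.contDiffAt, dρ_dz_comm hb.contDiffAt]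
        -- The two squares are those of the real and imaginary parts of L*w, up to sign.
        nlinarith [sq_nonneg (dz a p + dρ b p + dz φ p * a p + dρ φ p * b p),
          sq_nonneg (dz b p - dρ a p + dz φ p * b p - dρ φ p * a p)]

/-! ### Cutoffs and the Carleman inequality for a gradient -/

/-- Lets functions that are controlled only on D enter integrals over the whole plane; outside the
support of the cutoff the product is locally zero. -/
theorem contDiff_cutoff_mul {D : Set (ℝ × ℝ)} {η A : ℝ × ℝ → ℝ} {n : WithTop ℕ∞}
    (hη : ContDiff ℝ n η) (hηD : tsupport η ⊆ D) (hA : ∀ p ∈ D, ContDiffAt ℝ n A p) :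
    ContDiff ℝ n (fun p => η p * A p) := by
  refine contDiff_iff_contDiffAt.2 fun p => ?_
  by_cases hp : p ∈ tsupport η
  · exact hη.contDiffAt.mul (hA p (hηD hp))
  · refine (contDiffAt_const (c := (0 : ℝ))).congr_of_eventuallyEq ?_
    filter_upwards [notMem_tsupport_iff_eventuallyEq.1 hp] with q hq
    simp [hq]

theorem continuous_cutoff_mul {D : Set (ℝ × ℝ)} {η A : ℝ × ℝ → ℝ}
    (hη : Continuous η) (hηD : tsupport η ⊆ D) (hA : ∀ p ∈ D, ContinuousAt A p) :
    Continuous (fun p => η p * A p) := by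
  refine continuous_iff_continuousAt.2 fun p => ?_
  by_cases hp : p ∈ tsupport η
  · exact hη.continuousAt.mul (hA p (hηD hp))
  · refine (continuousAt_const (y := (0 : ℝ))).congr ?_
    filter_upwards [notMem_tsupport_iff_eventuallyEq.1 hp] with q hq
    simp [hq]

theorem integrable_cutoff_mul {D : Set (ℝ × ℝ)} {η A : ℝ × ℝ → ℝ}
    (hη : Continuous η) (hc : HasCompactSupport η) (hηD : tsupport η ⊆ D)
    (hA : ∀ p ∈ D, ContinuousAt A p) : Integrable (fun p => η p * A p) :=
  (continuous_cutoff_mul hη hηD hA).integrable_of_hasCompactSupport hc.mul_right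

/-- The squared Euclidean norm of the gradient. -/
def gradSq (g : ℝ × ℝ → ℝ) (p : ℝ × ℝ) : ℝ := dz g p ^ 2 + dρ g p ^ 2

/-- The Laplacian of the Euclidean plane. -/
def planarLaplacian (g : ℝ × ℝ → ℝ) (p : ℝ × ℝ) : ℝ := dz (dz g) p + dρ (dρ g) p

/-- The squared Euclidean distance. -/
def sqDist (q p : ℝ × ℝ) : ℝ := (p.1 - q.1) ^ 2 + (p.2 - q.2) ^ 2

theorem gradSq_nonneg (g : ℝ × ℝ → ℝ) (p : ℝ × ℝ) : 0 ≤ gradSq g p := by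
  unfold gradSq; positivity

/-- Apply `carleman` to w = ηe^φ(g_z - i g_ρ). Since ∂̄ of g_z - i g_ρ is Δg/2, the factor e^φ
cancels the φ-terms of L, and Lw is e^φ times ηΔg plus terms containing only ∇η and ∇g. -/
theorem carleman_gradient {D : Set (ℝ × ℝ)} {g η φ : ℝ × ℝ → ℝ}
    (hg : ∀ p ∈ D, ContDiffAt ℝ (⊤ : ℕ∞) g p) (hη : ContDiff ℝ (⊤ : ℕ∞) η)
    (hc : HasCompactSupport η) (hηD : tsupport η ⊆ D) (hφ : ContDiff ℝ (⊤ : ℕ∞) φ) :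
    ∫ p, η p * (η p * (planarLaplacian φ p * gradSq g p * Real.exp (φ p) ^ 2)) ≤
      ∫ p, (η p * (η p * (planarLaplacian g p ^ 2 * Real.exp (φ p) ^ 2)) +
        (dz η p * (dz η p * (gradSq g p * Real.exp (φ p) ^ 2)) +
        dρ η p * (dρ η p * (gradSq g p * Real.exp (φ p) ^ 2)))) := by
  set a : ℝ × ℝ → ℝ := fun p => η p * (dz g p * Real.exp (φ p)) with had
  set b : ℝ × ℝ → ℝ := fun p => η p * (-dρ g p * Real.exp (φ p)) with hbd
  have ha : ContDiff ℝ (⊤ : ℕ∞) a := contDiff_cutoff_mul hη hηD fun p hp =>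
    (contDiffAt_dz (hg p hp)).mul hφ.contDiffAt.exp
  have hb : ContDiff ℝ (⊤ : ℕ∞) b := contDiff_cutoff_mul hη hηD fun p hp =>
    (contDiffAt_dρ (hg p hp)).neg.mul hφ.contDiffAt.exp
  have hac : HasCompactSupport a := hc.mul_right
  have hbc : HasCompactSupport b := hc.mul_right
  have key := carleman hφ ha hb hac hbc
  have hη' : Continuous η := hη.continuous
  have hηz := (contDiff_dz hη).continuous
  have hηρ := (contDiff_dρ hη).continuous
  have hcz : HasCompactSupport (dz η) := hc.fderiv_apply ℝ _
  have hcρ : HasCompactSupport (dρ η) := hc.fderiv_apply ℝ _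
  have hDz : tsupport (dz η) ⊆ D := (tsupport_fderiv_apply_subset ℝ _).trans hηD
  have hDρ : tsupport (dρ η) ⊆ D := (tsupport_fderiv_apply_subset ℝ _).trans hηD
  have cφ := hφ.continuous
  have c1 : ∀ p ∈ D, ContinuousAt (planarLaplacian g) p := fun p hp =>
    (contDiffAt_dz (contDiffAt_dz (hg p hp))).continuousAt.add
      (contDiffAt_dρ (contDiffAt_dρ (hg p hp))).continuousAt
  have c2 : ∀ p ∈ D, ContinuousAt (gradSq g) p := fun p hp =>
    ((contDiffAt_dz (hg p hp)).continuousAt.pow 2).add ((contDiffAt_dρ (hg p hp)).continuousAt.pow 2)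
  have hi : Integrable (fun p => (η p * (η p * (planarLaplacian g p ^ 2 * Real.exp (φ p) ^ 2)) +
        (dz η p * (dz η p * (gradSq g p * Real.exp (φ p) ^ 2)) +
        dρ η p * (dρ η p * (gradSq g p * Real.exp (φ p) ^ 2))))) := by
    refine Integrable.add ?_ (Integrable.add ?_ ?_)
    · refine integrable_cutoff_mul hη' hc hηD fun p hp => ?_
      have := c1 p hp
      fun_prop
    · refine integrable_cutoff_mul hηz hcz hDz fun p hp => ?_
      have := c2 p hp
      fun_prop
    · refine integrable_cutoff_mul hηρ hcρ hDρ fun p hp => ?_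
      have := c2 p hp
      fun_prop
  have e1 : ∫ p, 2 * (dz (dz φ) p + dρ (dρ φ) p) * (a p ^ 2 + b p ^ 2)
      = 2 * ∫ p, η p * (η p * (planarLaplacian φ p * gradSq g p * Real.exp (φ p) ^ 2)) := by
    rw [← integral_const_mul]
    congr 1 with p
    simp only [had, hbd, gradSq, planarLaplacian]
    ring
  have e2 : ∫ p, ((dz a p - dρ b p - dz φ p * a p + dρ φ p * b p) ^ 2 +
        (dz b p + dρ a p - dz φ p * b p - dρ φ p * a p) ^ 2) ≤
      2 * ∫ p, (η p * (η p * (planarLaplacian g p ^ 2 * Real.exp (φ p) ^ 2)) +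
        (dz η p * (dz η p * (gradSq g p * Real.exp (φ p) ^ 2)) +
        dρ η p * (dρ η p * (gradSq g p * Real.exp (φ p) ^ 2)))) := by
    rw [← integral_const_mul]
    refine integral_mono_of_nonneg (Eventually.of_forall fun p => by positivity)
      (hi.const_mul 2) (Eventually.of_forall fun p => ?_)
    by_cases hp : p ∈ D
    · have d1 : DifferentiableAt ℝ (dz g) p := (contDiffAt_dz (hg p hp)).differentiableAt (by simp)
      have d2 : DifferentiableAt ℝ (dρ g) p := (contDiffAt_dρ (hg p hp)).differentiableAt (by simp)
      have d3 : DifferentiableAt ℝ η p := hη.differentiable (by simp) p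
      have d4 : DifferentiableAt ℝ φ p := hφ.differentiable (by simp) p
      have A1 : dz a p = (dz η p * dz g p + η p * dz (dz g) p + η p * dz g p * dz φ p)
          * Real.exp (φ p) := by
        rw [had, dz_mul (by fun_prop) (by fun_prop), dz_mul (by fun_prop) (by fun_prop), dz_exp d4]
        ring
      have A2 : dρ a p = (dρ η p * dz g p + η p * dρ (dz g) p + η p * dz g p * dρ φ p)
          * Real.exp (φ p) := by
        rw [had, dρ_mul (by fun_prop) (by fun_prop), dρ_mul (by fun_prop) (by fun_prop), dρ_exp d4]
        ring
      have B1 : dz b p = -(dz η p * dρ g p + η p * dz (dρ g) p + η p * dρ g p * dz φ p)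
          * Real.exp (φ p) := by
        rw [hbd, dz_mul (by fun_prop) (by fun_prop), dz_mul (by fun_prop) (by fun_prop), dz_exp d4,
          dz_neg]
        ring
      have B2 : dρ b p = -(dρ η p * dρ g p + η p * dρ (dρ g) p + η p * dρ g p * dρ φ p)
          * Real.exp (φ p) := by
        rw [hbd, dρ_mul (by fun_prop) (by fun_prop), dρ_mul (by fun_prop) (by fun_prop), dρ_exp d4,
          dρ_neg]
        ring
      have P : dz a p - dρ b p - dz φ p * a p + dρ φ p * b p
          = (η p * planarLaplacian g p + (dz η p * dz g p + dρ η p * dρ g p))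
            * Real.exp (φ p) := by
        rw [A1, B2]; simp only [had, hbd, planarLaplacian]; ring
      -- The second derivatives of g cancel here because mixed partial derivatives agree.
      have Q : dz b p + dρ a p - dz φ p * b p - dρ φ p * a p
          = (dρ η p * dz g p - dz η p * dρ g p) * Real.exp (φ p) := by
        rw [A2, B1, dρ_dz_comm (hg p hp)]; simp only [had, hbd]; ring
      simp only [P, Q, mul_pow]
      rw [← add_mul]
      -- Uses (x + y)² ≤ 2x² + 2y² and |∇η|²|∇g|² = (∇η·∇g)² + (η_ρ g_z - η_z g_ρ)². The factor 2
      -- balances the one on the left of `carleman`.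
      calc _ ≤ (2 * (η p * (η p * planarLaplacian g p ^ 2) + (dz η p * (dz η p * gradSq g p)
            + dρ η p * (dρ η p * gradSq g p)))) * Real.exp (φ p) ^ 2 := by
            refine mul_le_mul_of_nonneg_right ?_ (by positivity)
            simp only [gradSq]
            nlinarith [sq_nonneg (η p * planarLaplacian g p - (dz η p * dz g p + dρ η p * dρ g p)),
              sq_nonneg (dρ η p * dz g p - dz η p * dρ g p)]
        _ = _ := by ring
    · have h1 : p ∉ tsupport η := fun h => hp (hηD h)
      have h2 : p ∉ tsupport a := fun h => h1 (tsupport_mul_subset_left h)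
      have h3 : p ∉ tsupport b := fun h => h1 (tsupport_mul_subset_left h)
      simp [dz_eq_zero_of_notMem_tsupport h1, dρ_eq_zero_of_notMem_tsupport h1,
        dz_eq_zero_of_notMem_tsupport h2, dρ_eq_zero_of_notMem_tsupport h2,
        dz_eq_zero_of_notMem_tsupport h3, dρ_eq_zero_of_notMem_tsupport h3,
        image_eq_zero_of_notMem_tsupport h1, image_eq_zero_of_notMem_tsupport h2,
        image_eq_zero_of_notMem_tsupport h3]
  linarith

/-! ### The Gaussian exponent, Euclidean distance and radial cutoffs -/

theorem dz_fst (p : ℝ × ℝ) : dz (fun q : ℝ × ℝ => q.1) p = 1 := by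
  rw [hasFDerivAt_fst.dz]; rfl

theorem dz_snd (p : ℝ × ℝ) : dz (fun q : ℝ × ℝ => q.2) p = 0 := by
  rw [hasFDerivAt_snd.dz]; rfl

theorem dρ_fst (p : ℝ × ℝ) : dρ (fun q : ℝ × ℝ => q.1) p = 0 := by
  rw [hasFDerivAt_fst.dρ]; rfl

theorem dρ_snd (p : ℝ × ℝ) : dρ (fun q : ℝ × ℝ => q.2) p = 1 := by
  rw [hasFDerivAt_snd.dρ]; rfl

theorem contDiff_sqDist (q : ℝ × ℝ) {n : WithTop ℕ∞} : ContDiff ℝ n (sqDist q) := by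
  unfold sqDist; fun_prop

theorem dz_sqDist (q p : ℝ × ℝ) : dz (sqDist q) p = 2 * (p.1 - q.1) := by
  have : sqDist q = fun p => (p.1 - q.1) * (p.1 - q.1) + (p.2 - q.2) * (p.2 - q.2) := by
    ext p; unfold sqDist; ring
  rw [this, dz_add (by fun_prop) (by fun_prop), dz_mul (by fun_prop) (by fun_prop),
    dz_mul (by fun_prop) (by fun_prop), dz_sub (by fun_prop) (by fun_prop),
    dz_sub (by fun_prop) (by fun_prop), dz_fst, dz_snd, dz_const, dz_const]
  ring

theorem dρ_sqDist (q p : ℝ × ℝ) : dρ (sqDist q) p = 2 * (p.2 - q.2) := by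
  have : sqDist q = fun p => (p.1 - q.1) * (p.1 - q.1) + (p.2 - q.2) * (p.2 - q.2) := by
    ext p; unfold sqDist; ring
  rw [this, dρ_add (by fun_prop) (by fun_prop), dρ_mul (by fun_prop) (by fun_prop),
    dρ_mul (by fun_prop) (by fun_prop), dρ_sub (by fun_prop) (by fun_prop),
    dρ_sub (by fun_prop) (by fun_prop), dρ_fst, dρ_snd, dρ_const, dρ_const]
  ring

theorem contDiff_gaussian (q : ℝ × ℝ) (t l : ℝ) :
    ContDiff ℝ (⊤ : ℕ∞) (fun p => t * Real.exp (-l * sqDist q p)) := by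
  have := contDiff_sqDist q (n := (⊤ : ℕ∞))
  fun_prop

/-- The factor `l * sqDist q p - 1` shows that, for t and l positive, this exponent is strictly
subharmonic away from a small disc about q, while it decreases radially. -/
theorem planarLaplacian_gaussian (q : ℝ × ℝ) (t l : ℝ) (p : ℝ × ℝ) :
    planarLaplacian (fun p => t * Real.exp (-l * sqDist q p)) p
      = t * (4 * l * (l * sqDist q p - 1) * Real.exp (-l * sqDist q p)) := by
  have hd : Differentiable ℝ (sqDist q) := (contDiff_sqDist q).differentiable one_ne_zero
  have h1 : dz (fun p => t * Real.exp (-l * sqDist q p)) =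
      fun p => (t * Real.exp (-l * sqDist q p)) * (-l * (2 * (p.1 - q.1))) := by
    ext p
    rw [dz_const_mul _ (by fun_prop), dz_exp (by fun_prop), dz_const_mul _ (by fun_prop), dz_sqDist]
    ring
  have h2 : dρ (fun p => t * Real.exp (-l * sqDist q p)) =
      fun p => (t * Real.exp (-l * sqDist q p)) * (-l * (2 * (p.2 - q.2))) := by
    ext p
    rw [dρ_const_mul _ (by fun_prop), dρ_exp (by fun_prop), dρ_const_mul _ (by fun_prop), dρ_sqDist]
    ring
  rw [planarLaplacian, h1, h2, dz_mul (by fun_prop) (by fun_prop),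
    dρ_mul (by fun_prop) (by fun_prop), h1, h2, dz_const_mul _ (by fun_prop),
    dρ_const_mul _ (by fun_prop), dz_const_mul _ (by fun_prop),
    dρ_const_mul _ (by fun_prop), dz_sub (by fun_prop) (by fun_prop),
    dρ_sub (by fun_prop) (by fun_prop), dz_fst, dρ_snd, dz_const, dρ_const]
  simp only [sqDist]
  ring

theorem dist_le_of_sqDist_le {q p : ℝ × ℝ} {s : ℝ} (hs : 0 ≤ s) (h : sqDist q p ≤ s ^ 2) :
    dist p q ≤ s := by
  unfold sqDist at h
  rw [Prod.dist_eq, Real.dist_eq, Real.dist_eq]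
  exact max_le (abs_le_of_sq_le_sq (by nlinarith [sq_nonneg (p.2 - q.2)]) hs)
    (abs_le_of_sq_le_sq (by nlinarith [sq_nonneg (p.1 - q.1)]) hs)

/-- The distance of the product is the maximum of the coordinate distances, hence the factor 2. -/
theorem sqDist_le_of_dist_le {q p : ℝ × ℝ} {s : ℝ} (h : dist p q ≤ s) :
    sqDist q p ≤ 2 * s ^ 2 := by
  rw [Prod.dist_eq, Real.dist_eq, Real.dist_eq] at h
  have h1 := sq_le_sq' (by linarith [neg_abs_le (p.1 - q.1), (max_le_iff.1 h).1])
    ((le_abs_self _).trans (max_le_iff.1 h).1)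
  have h2 := sq_le_sq' (by linarith [neg_abs_le (p.2 - q.2), (max_le_iff.1 h).2])
    ((le_abs_self _).trans (max_le_iff.1 h).2)
  unfold sqDist
  linarith

theorem exists_cutoff (q : ℝ × ℝ) {s t : ℝ} (hst : s < t) :
    ∃ η : ℝ × ℝ → ℝ, ContDiff ℝ (⊤ : ℕ∞) η ∧ HasCompactSupport η ∧
      tsupport η ⊆ {p | sqDist q p ≤ t} ∧ (∀ p, sqDist q p ≤ s → η p = 1) := by
  have hsq := contDiff_sqDist q (n := (⊤ : ℕ∞))
  have hsup : tsupport (fun p => Real.smoothTransition ((t - sqDist q p) / (t - s)))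
      ⊆ {p | sqDist q p ≤ t} := by
    refine closure_minimal (fun p hp => ?_) (isClosed_le hsq.continuous continuous_const)
    by_contra h
    refine hp (Real.smoothTransition.zero_of_nonpos (div_nonpos_of_nonpos_of_nonneg ?_ ?_))
    · simp only [Set.mem_ofPred_eq, not_le] at h; linarith
    · linarith
  refine ⟨fun p => Real.smoothTransition ((t - sqDist q p) / (t - s)),
    Real.smoothTransition.contDiff.comp (by fun_prop), ?_, hsup, fun p hp => ?_⟩
  · refine (isCompact_closedBall q (t ^ 2 + 1)).of_isClosed_subset (isClosed_tsupport _)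
      fun p hp => ?_
    refine dist_le_of_sqDist_le (by positivity) ((hsup hp : sqDist q p ≤ t).trans ?_)
    nlinarith [sq_nonneg (t ^ 2 - t), sq_nonneg (t - 1), sq_nonneg t]
  · exact Real.smoothTransition.one_of_one_le ((one_le_div (by linarith)).2 (by linarith))

/-! ### Weak unique continuation for real functions -/

/-- The numbers r, s, t are squared radii. In the Carleman inequality with exponent T·exp(-l|p -
q|²), the gradient term gains a factor of order T outside the inner disc, where subharmonicity
holds, and is zero inside it. The cutoff error lives at squared distance at least s, where the
weight is at most its value there. Dividing by that value and letting T grow forces the gradients to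
vanish inside s. -/
theorem gradSq_add_eq_zero_of_annulus {D : Set (ℝ × ℝ)} {g h : ℝ × ℝ → ℝ}
    (hg : ∀ p ∈ D, ContDiffAt ℝ (⊤ : ℕ∞) g p) (hh : ∀ p ∈ D, ContDiffAt ℝ (⊤ : ℕ∞) h p)
    {q : ℝ × ℝ} {r s t M : ℝ} (hr : 0 < r) (hst : s < t) (hD : {p | sqDist q p ≤ t} ⊆ D)
    (hM0 : 0 ≤ M)
    (hM : ∀ p, sqDist q p ≤ t → planarLaplacian g p ^ 2 + planarLaplacian h p ^ 2
      ≤ M * (gradSq g p + gradSq h p))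
    (hz : ∀ p, sqDist q p < r → gradSq g p + gradSq h p = 0) :
    ∀ p, sqDist q p < s → gradSq g p + gradSq h p = 0 := by
  obtain ⟨η, hη, hc, hsup, hη1⟩ := exists_cutoff q hst
  have hηD := hsup.trans hD
  set S : ℝ × ℝ → ℝ := fun p => gradSq g p + gradSq h p with hS
  have S0 : ∀ p, 0 ≤ S p := fun p => add_nonneg (gradSq_nonneg g p) (gradSq_nonneg h p)
  have hη' : Continuous η := hη.continuous
  have hηz := (contDiff_dz hη).continuous
  have hηρ := (contDiff_dρ hη).continuous
  have hcz : HasCompactSupport (dz η) := hc.fderiv_apply ℝ _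
  have hcρ : HasCompactSupport (dρ η) := hc.fderiv_apply ℝ _
  have hDz : tsupport (dz η) ⊆ D := (tsupport_fderiv_apply_subset ℝ _).trans hηD
  have hDρ : tsupport (dρ η) ⊆ D := (tsupport_fderiv_apply_subset ℝ _).trans hηD
  have cg : ∀ p ∈ D, ContinuousAt (gradSq g) p := fun p hp =>
    ((contDiffAt_dz (hg p hp)).continuousAt.pow 2).add ((contDiffAt_dρ (hg p hp)).continuousAt.pow 2)
  have ch : ∀ p ∈ D, ContinuousAt (gradSq h) p := fun p hp =>
    ((contDiffAt_dz (hh p hp)).continuousAt.pow 2).add ((contDiffAt_dρ (hh p hp)).continuousAt.pow 2)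
  have clg : ∀ p ∈ D, ContinuousAt (planarLaplacian g) p := fun p hp =>
    (contDiffAt_dz (contDiffAt_dz (hg p hp))).continuousAt.add
      (contDiffAt_dρ (contDiffAt_dρ (hg p hp))).continuousAt
  have clh : ∀ p ∈ D, ContinuousAt (planarLaplacian h) p := fun p hp =>
    (contDiffAt_dz (contDiffAt_dz (hh p hp))).continuousAt.add
      (contDiffAt_dρ (contDiffAt_dρ (hh p hp))).continuousAt
  have cS : ∀ p ∈ D, ContinuousAt S p := fun p hp => (cg p hp).add (ch p hp)
  have cq : Continuous (sqDist q) := (contDiff_sqDist q (n := 0)).continuous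
  -- A continuous substitute for the indicator of the disc of squared radius s: positive inside it,
  -- zero outside, at most 1.
  set κ : ℝ × ℝ → ℝ := fun p => max 0 (min 1 (s - sqDist q p)) with hκ
  have κ0 : ∀ p, 0 ≤ κ p := fun p => le_max_left _ _
  have κ1 : ∀ p, κ p ≤ 1 := fun p => max_le zero_le_one (min_le_left _ _)
  have κz : ∀ p, s ≤ sqDist q p → κ p = 0 := fun p hp =>
    max_eq_left ((min_le_right _ _).trans (by linarith))
  have cκ : Continuous κ := by fun_prop
  have ck : Continuous (fun p => η p * (η p * S p * κ p)) :=
    continuous_cutoff_mul hη' hηD fun p hp => by have := cS p hp; fun_prop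
  have hkc : HasCompactSupport (fun p => η p * (η p * S p * κ p)) := hc.mul_right
  have k0 : ∀ p, 0 ≤ η p * (η p * S p * κ p) := fun p => by
    have := mul_nonneg (mul_nonneg (mul_self_nonneg (η p)) (S0 p)) (κ0 p)
    linarith
  -- With this l, l·sqDist - 1 ≥ 1 once sqDist ≥ r, so the Laplacian of the exponent is at least T·c
  -- on the rest of the support of η.
  set l : ℝ := 2 / r with hl
  have l0 : 0 < l := by positivity
  set c : ℝ := 4 * l * Real.exp (-l * t) with hcdef
  have c0 : 0 < c := by positivity
  set K : ℝ := ∫ p, (dz η p * (dz η p * S p) + dρ η p * (dρ η p * S p)) with hK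
  have iK : Integrable (fun p => dz η p * (dz η p * S p) + dρ η p * (dρ η p * S p)) := by
    refine Integrable.add ?_ ?_
    · refine integrable_cutoff_mul hηz hcz hDz fun p hp => ?_
      have := cS p hp
      fun_prop
    · refine integrable_cutoff_mul hηρ hcρ hDρ fun p hp => ?_
      have := cS p hp
      fun_prop
  have K0 : 0 ≤ K := integral_nonneg fun p => by
    have := mul_nonneg (mul_self_nonneg (dz η p)) (S0 p)
    have := mul_nonneg (mul_self_nonneg (dρ η p)) (S0 p)
    simp only [Pi.zero_apply]
    linarith
  set J : ℝ := ∫ p, η p * (η p * S p * κ p) with hJ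
  have J0 : 0 ≤ J := integral_nonneg k0
  have main : ∀ T : ℝ, 0 ≤ T → M ≤ T * c → (T * c - M) * J ≤ K := by
    intro T hT hTc
    set φ : ℝ × ℝ → ℝ := fun p => T * Real.exp (-l * sqDist q p) with hφd
    have hφ : ContDiff ℝ (⊤ : ℕ∞) φ := contDiff_gaussian q T l
    have cφ := hφ.continuous
    have clφ : Continuous (planarLaplacian φ) :=
      (contDiff_dz (contDiff_dz hφ)).continuous.add (contDiff_dρ (contDiff_dρ hφ)).continuous
    have kg := carleman_gradient hg hη hc hηD hφ
    have kh := carleman_gradient hh hη hc hηD hφ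
    set w : ℝ × ℝ → ℝ := fun p => Real.exp (φ p) ^ 2 with hw
    have cw : Continuous w := by fun_prop
    have w0 : ∀ p, 0 < w p := fun p => by positivity
    -- The value of the squared weight on the circle sqDist = s; it separates the weights inside
    -- from those outside.
    set W : ℝ := Real.exp (T * Real.exp (-l * s)) ^ 2 with hW
    have W0 : 0 < W := by positivity
    have wW : ∀ p, sqDist q p ≤ s → W ≤ w p := fun p hp => by
      have : Real.exp (-l * s) ≤ Real.exp (-l * sqDist q p) := Real.exp_le_exp.2 (by nlinarith)
      simp only [hW, hw, hφd]
      gcongr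
    have Ww : ∀ p, s ≤ sqDist q p → w p ≤ W := fun p hp => by
      have : Real.exp (-l * sqDist q p) ≤ Real.exp (-l * s) := Real.exp_le_exp.2 (by nlinarith)
      simp only [hW, hw, hφd]
      gcongr
    have a1 : Integrable (fun p => η p * (η p * (planarLaplacian φ p * gradSq g p * w p))) :=
      integrable_cutoff_mul hη' hc hηD fun p hp => by have := cg p hp; fun_prop
    have a2 : Integrable (fun p => η p * (η p * (planarLaplacian φ p * gradSq h p * w p))) :=
      integrable_cutoff_mul hη' hc hηD fun p hp => by have := ch p hp; fun_prop
    have a3 : Integrable (fun p => η p * (η p * (planarLaplacian g p ^ 2 * w p))) :=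
      integrable_cutoff_mul hη' hc hηD fun p hp => by have := clg p hp; fun_prop
    have a4 : Integrable (fun p => η p * (η p * (planarLaplacian h p ^ 2 * w p))) :=
      integrable_cutoff_mul hη' hc hηD fun p hp => by have := clh p hp; fun_prop
    have a5 : Integrable (fun p => dz η p * (dz η p * (gradSq g p * w p))) :=
      integrable_cutoff_mul hηz hcz hDz fun p hp => by have := cg p hp; fun_prop
    have a6 : Integrable (fun p => dρ η p * (dρ η p * (gradSq g p * w p))) :=
      integrable_cutoff_mul hηρ hcρ hDρ fun p hp => by have := cg p hp; fun_prop
    have a7 : Integrable (fun p => dz η p * (dz η p * (gradSq h p * w p))) :=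
      integrable_cutoff_mul hηz hcz hDz fun p hp => by have := ch p hp; fun_prop
    have a8 : Integrable (fun p => dρ η p * (dρ η p * (gradSq h p * w p))) :=
      integrable_cutoff_mul hηρ hcρ hDρ fun p hp => by have := ch p hp; fun_prop
    have b1 : Integrable (fun p => η p * (η p * (planarLaplacian g p ^ 2 * w p)) +
        (dz η p * (dz η p * (gradSq g p * w p)) + dρ η p * (dρ η p * (gradSq g p * w p)))) :=
      a3.add (a5.add a6)
    have b2 : Integrable (fun p => η p * (η p * (planarLaplacian h p ^ 2 * w p)) +
        (dz η p * (dz η p * (gradSq h p * w p)) + dρ η p * (dρ η p * (gradSq h p * w p)))) :=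
      a4.add (a7.add a8)
    have a12 : Integrable (fun p => η p * (η p * (planarLaplacian φ p * gradSq g p * w p)) +
        η p * (η p * (planarLaplacian φ p * gradSq h p * w p))) := a1.add a2
    have b12 : Integrable (fun p => (η p * (η p * (planarLaplacian g p ^ 2 * w p)) +
        (dz η p * (dz η p * (gradSq g p * w p)) + dρ η p * (dρ η p * (gradSq g p * w p)))) +
        (η p * (η p * (planarLaplacian h p ^ 2 * w p)) +
        (dz η p * (dz η p * (gradSq h p * w p)) + dρ η p * (dρ η p * (gradSq h p * w p))))) :=
      b1.add b2
    have iW : Integrable (fun p => W * (dz η p * (dz η p * S p) + dρ η p * (dρ η p * S p))) :=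
      iK.const_mul W
    have step : ∫ p, ((T * c - M) * W) * (η p * (η p * S p * κ p)) ≤
        (∫ p, (η p * (η p * (planarLaplacian φ p * gradSq g p * w p)) +
          η p * (η p * (planarLaplacian φ p * gradSq h p * w p)))) -
        (∫ p, ((η p * (η p * (planarLaplacian g p ^ 2 * w p)) +
        (dz η p * (dz η p * (gradSq g p * w p)) + dρ η p * (dρ η p * (gradSq g p * w p)))) +
        (η p * (η p * (planarLaplacian h p ^ 2 * w p)) +
        (dz η p * (dz η p * (gradSq h p * w p)) + dρ η p * (dρ η p * (gradSq h p * w p)))))) +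
        ∫ p, W * (dz η p * (dz η p * S p) + dρ η p * (dρ η p * S p)) := by
      refine (integral_mono ((ck.integrable_of_hasCompactSupport hkc).const_mul _)
        ((a12.sub b12).add iW) fun p => ?_).trans_eq
        ((integral_add (a12.sub b12) iW).trans (congrArg (· + _) (integral_sub a12 b12)))
      -- Inside the circle the derivatives of η vanish; outside, the weight is at most W.
      have hgrad : 0 ≤ (W - w p) * (dz η p * (dz η p * S p) + dρ η p * (dρ η p * S p)) := by
        rcases lt_or_ge (sqDist q p) s with hp | hp
        · have he : η =ᶠ[𝓝 p] fun _ => 1 := by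
            filter_upwards [(isOpen_lt cq continuous_const).mem_nhds hp] with x hx
            exact hη1 x (le_of_lt hx)
          simp [dz_congr he, dρ_congr he, dz_const, dρ_const]
        · have := mul_nonneg (mul_self_nonneg (dz η p)) (S0 p)
          have := mul_nonneg (mul_self_nonneg (dρ η p)) (S0 p)
          exact mul_nonneg (by linarith [Ww p hp]) (by linarith)
      have hmain : (T * c - M) * W * (η p * (η p * S p * κ p)) ≤
          η p ^ 2 * w p * (planarLaplacian φ p * S p
            - (planarLaplacian g p ^ 2 + planarLaplacian h p ^ 2)) := by
        rcases lt_or_ge t (sqDist q p) with hp | hp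
        · have : η p = 0 := image_eq_zero_of_notMem_tsupport fun h' => by
            have : sqDist q p ≤ t := hsup h'
            linarith
          simp [this]
        · have hMp := hM p hp
          rcases lt_or_ge (sqDist q p) r with hp' | hp'
          -- In the inner disc the Laplacians vanish with the gradients by the differential
          -- inequality, so the sign of the Laplacian of φ does not matter.
          · have hSp : S p = 0 := hz p hp'
            have : planarLaplacian g p ^ 2 + planarLaplacian h p ^ 2 = 0 :=
              le_antisymm (by simpa [hS] using hMp.trans_eq (congrArg (M * ·) hSp)) (by positivity)
            simp [this, hSp]
          · have hφc : T * c ≤ planarLaplacian φ p := by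
              rw [hφd, planarLaplacian_gaussian, hcdef]
              have h1 : 1 ≤ l * sqDist q p - 1 := by
                have : l * r ≤ l * sqDist q p := by gcongr
                have : l * r = 2 := by rw [hl]; field_simp
                linarith
              have h2 : Real.exp (-l * t) ≤ Real.exp (-l * sqDist q p) :=
                Real.exp_le_exp.2 (by nlinarith)
              have h3 : 4 * l * 1 ≤ 4 * l * (l * sqDist q p - 1) := by gcongr
              refine mul_le_mul_of_nonneg_left ?_ hT
              refine mul_le_mul (by linarith) h2 (by positivity) (by nlinarith)
            have e1 : (T * c - M) * S p ≤ planarLaplacian φ p * S p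
                - (planarLaplacian g p ^ 2 + planarLaplacian h p ^ 2) := by
              have := mul_le_mul_of_nonneg_right hφc (S0 p)
              have : M * S p = M * (gradSq g p + gradSq h p) := rfl
              linarith
            have e2 : W * κ p ≤ w p := by
              rcases le_or_gt s (sqDist q p) with hs | hs
              · simp [κz p hs, (w0 p).le]
              · nlinarith [wW p hs.le, κ1 p, κ0 p]
            calc (T * c - M) * W * (η p * (η p * S p * κ p))
                = η p ^ 2 * (((T * c - M) * S p) * (W * κ p)) := by ring
              _ ≤ η p ^ 2 * (((T * c - M) * S p) * w p) := by
                  refine mul_le_mul_of_nonneg_left ?_ (sq_nonneg _)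
                  exact mul_le_mul_of_nonneg_left e2
                    (mul_nonneg (by linarith) (S0 p))
              _ ≤ η p ^ 2 * ((planarLaplacian φ p * S p
                - (planarLaplacian g p ^ 2 + planarLaplacian h p ^ 2)) * w p) := by
                  refine mul_le_mul_of_nonneg_left ?_ (sq_nonneg _)
                  exact mul_le_mul_of_nonneg_right e1 (w0 p).le
              _ = _ := by ring
      simp only [Pi.add_apply, Pi.sub_apply, hS] at hgrad hmain ⊢
      linarith
    rw [integral_add a1 a2, integral_add b1 b2, integral_const_mul, integral_const_mul] at step
    have fin : (T * c - M) * W * J ≤ W * K := by linarith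
    nlinarith
  -- If J > 0, choose T so that T·c - M = K/J + 1; then `main` would give K + J ≤ K.
  have hJ0 : J = 0 := by
    by_contra hne
    have Jpos : 0 < J := lt_of_le_of_ne J0 (Ne.symm hne)
    have hT : (M + K / J + 1) / c * c = M + K / J + 1 := by field_simp
    have := main ((M + K / J + 1) / c) (by positivity) (by
      rw [hT]; have : 0 ≤ K / J := by positivity
      linarith)
    rw [hT] at this
    have e : (M + K / J + 1 - M) * J = K + J := by field_simp; ring
    linarith
  intro p hp
  by_contra hne
  have hpos : 0 < ∫ p, η p * (η p * S p * κ p) := by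
    refine ck.integral_pos_of_hasCompactSupport_nonneg_nonzero hkc k0 (x := p) ?_
    have : 0 < κ p := lt_max_of_lt_right (lt_min one_pos (by linarith))
    simp [hη1 p hp.le, this.ne']
    exact hne
  exact hpos.ne' hJ0

/-- Weak unique continuation for gradients of solutions of a second-order differential inequality
in the plane. -/
theorem gradSq_add_eq_zero_of_unique_continuation {D V : Set (ℝ × ℝ)} {g h m : ℝ × ℝ → ℝ}
    (hDo : IsOpen D) (hDc : IsPreconnected D)
    (hg : ∀ p ∈ D, ContDiffAt ℝ (⊤ : ℕ∞) g p) (hh : ∀ p ∈ D, ContDiffAt ℝ (⊤ : ℕ∞) h p)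
    (hm : ContinuousOn m D)
    (hM : ∀ p ∈ D, planarLaplacian g p ^ 2 + planarLaplacian h p ^ 2
      ≤ m p * (gradSq g p + gradSq h p))
    (hV : IsOpen V) (hVne : (D ∩ V).Nonempty)
    (hz : ∀ p ∈ V, gradSq g p + gradSq h p = 0) :
    ∀ p ∈ D, gradSq g p + gradSq h p = 0 := by
  set Z : Set (ℝ × ℝ) := interior {p | gradSq g p + gradSq h p = 0} with hZ
  suffices D ⊆ Z by
    intro p hp
    have := interior_subset (this hp)
    exact this
  -- It suffices that the open set Z is relatively closed in D.
  refine hDc.subset_of_closure_inter_subset isOpen_interior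
    (hVne.mono (Set.inter_subset_inter_right _ (interior_maximal hz hV))) ?_
  rintro p ⟨hpZ, hpD⟩
  obtain ⟨ε, ε0, hε⟩ := Metric.isOpen_iff.1 hDo p hpD
  obtain ⟨q, hqZ, hq⟩ := Metric.mem_closure_iff.1 hpZ (ε / 4) (by positivity)
  obtain ⟨r, r0, hr⟩ := Metric.isOpen_iff.1 isOpen_interior q hqZ
  have cq : Continuous (sqDist q) := (contDiff_sqDist q (n := 0)).continuous
  have hsub : {x | sqDist q x ≤ (ε / 2) ^ 2} ⊆ D := fun x hx => hε <| by
    have h1 : dist x q ≤ ε / 2 := dist_le_of_sqDist_le (by positivity) hx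
    have h2 := dist_triangle x q p
    rw [dist_comm q p] at h2
    simp only [Metric.mem_ball]
    linarith
  have hcomp : IsCompact {x | sqDist q x ≤ (ε / 2) ^ 2} :=
    (isCompact_closedBall q (ε / 2)).of_isClosed_subset (isClosed_le cq continuous_const)
      fun x hx => dist_le_of_sqDist_le (by positivity) hx
  obtain ⟨B, hB⟩ := hcomp.bddAbove_image (hm.mono hsub)
  -- As dist p q < ε/4, sqDist q p ≤ ε²/8 < 3ε²/16 < ε²/4: the point p lies in the middle disc, and
  -- the outer disc stays in D.
  have hstep := gradSq_add_eq_zero_of_annulus hg hh (q := q) (r := (r / 2) ^ 2)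
    (s := 3 / 16 * ε ^ 2) (t := (ε / 2) ^ 2) (M := max B 0) (by positivity) (by nlinarith) hsub
    (le_max_right _ _) (fun x hx => (hM x (hsub hx)).trans ?_) fun x hx => ?_
  · refine mem_interior.2 ⟨{x | sqDist q x < 3 / 16 * ε ^ 2}, hstep,
      isOpen_lt cq continuous_const, ?_⟩
    have := sqDist_le_of_dist_le hq.le
    simp only [Set.mem_ofPred_eq]
    nlinarith
  · exact mul_le_mul_of_nonneg_right ((hB ⟨x, hx, rfl⟩).trans (le_max_left _ _))
      (add_nonneg (gradSq_nonneg g x) (gradSq_nonneg h x))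
  · refine (interior_subset (hr ?_) : x ∈ {p | gradSq g p + gradSq h p = 0})
    have : dist x q ≤ r / 2 := dist_le_of_sqDist_le (by positivity) hx.le
    simp only [Metric.mem_ball]
    linarith

/-! ### Operations on solutions: phase, additive constants, conjugation, reflection -/

section

section Operations

theorem im_two_mul_mul (a b : ℂ) : (2 * a * b).im = 2 * (a * b).im := by
  rw [mul_assoc, two_mul, Complex.add_im, two_mul]

theorem hasFDerivAt_reflect (z₀ : ℝ) (p : ℝ × ℝ) :
    HasFDerivAt (reflect z₀)
      ((-ContinuousLinearMap.fst ℝ ℝ ℝ).prod (ContinuousLinearMap.snd ℝ ℝ ℝ)) p :=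
  (hasFDerivAt_fst.const_sub (2 * z₀)).prodMk hasFDerivAt_snd

theorem reflect_reflect (z₀ : ℝ) (p : ℝ × ℝ) : reflect z₀ (reflect z₀ p) = p := by
  simp [reflect]

theorem contDiff_reflect (z₀ : ℝ) {n : WithTop ℕ∞} : ContDiff ℝ n (reflect z₀) := by
  unfold reflect; fun_prop

theorem differentiableAt_comp_reflect {F : Type*} [NormedAddCommGroup F] [NormedSpace ℝ F]
    (z₀ : ℝ) (A : ℝ × ℝ → F) (p : ℝ × ℝ) :
    DifferentiableAt ℝ (fun q => A (reflect z₀ q)) p ↔ DifferentiableAt ℝ A (reflect z₀ p) := by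
  refine ⟨fun h => ?_, fun h => h.comp p (hasFDerivAt_reflect z₀ p).differentiableAt⟩
  have h' : DifferentiableAt ℝ (fun q => A (reflect z₀ q)) (reflect z₀ (reflect z₀ p)) := by
    rwa [reflect_reflect]
  have := h'.comp (reflect z₀ p) (hasFDerivAt_reflect z₀ _).differentiableAt
  refine this.congr_of_eventuallyEq (Eventually.of_forall fun q => ?_)
  simp [reflect_reflect]

theorem dz_comp_reflect {F : Type*} [NormedAddCommGroup F] [NormedSpace ℝ F]
    (z₀ : ℝ) (A : ℝ × ℝ → F) :
    dz (fun q => A (reflect z₀ q)) = fun p => -dz A (reflect z₀ p) := by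
  ext p
  by_cases h : DifferentiableAt ℝ A (reflect z₀ p)
  · have := h.hasFDerivAt.comp p (hasFDerivAt_reflect z₀ p)
    rw [show (fun q => A (reflect z₀ q)) = A ∘ reflect z₀ from rfl, this.dz]
    change fderiv ℝ A (reflect z₀ p) (-1, 0) = -fderiv ℝ A (reflect z₀ p) (1, 0)
    rw [← map_neg, Prod.neg_mk, neg_zero]
  · rw [dz, dz, fderiv_zero_of_not_differentiableAt h, fderiv_zero_of_not_differentiableAt
      (fun h' => h ((differentiableAt_comp_reflect z₀ A p).1 h'))]
    simp

theorem dρ_comp_reflect {F : Type*} [NormedAddCommGroup F] [NormedSpace ℝ F]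
    (z₀ : ℝ) (A : ℝ × ℝ → F) :
    dρ (fun q => A (reflect z₀ q)) = fun p => dρ A (reflect z₀ p) := by
  ext p
  by_cases h : DifferentiableAt ℝ A (reflect z₀ p)
  · have := h.hasFDerivAt.comp p (hasFDerivAt_reflect z₀ p)
    rw [show (fun q => A (reflect z₀ q)) = A ∘ reflect z₀ from rfl, this.dρ]
    simp [dρ]
  · rw [dρ, dρ, fderiv_zero_of_not_differentiableAt h, fderiv_zero_of_not_differentiableAt
      (fun h' => h ((differentiableAt_comp_reflect z₀ A p).1 h'))]

theorem dz_conj (A : ℝ × ℝ → ℂ) : dz (fun q => conj (A q)) = fun p => conj (dz A p) := by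
  ext p
  have := Complex.conjCLE.comp_fderiv (f := A) (x := p)
  exact congrArg (fun L : ℝ × ℝ →L[ℝ] ℂ => L (1, 0)) this

theorem dρ_conj (A : ℝ × ℝ → ℂ) : dρ (fun q => conj (A q)) = fun p => conj (dρ A p) := by
  ext p
  have := Complex.conjCLE.comp_fderiv (f := A) (x := p)
  exact congrArg (fun L : ℝ × ℝ →L[ℝ] ℂ => L (0, 1)) this

theorem dz_im {A : ℝ × ℝ → ℂ} {p : ℝ × ℝ} (h : DifferentiableAt ℝ A p) :
    dz (fun q => (A q).im) p = (dz A p).im := dz_clm Complex.imCLM h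

theorem dρ_im {A : ℝ × ℝ → ℂ} {p : ℝ × ℝ} (h : DifferentiableAt ℝ A p) :
    dρ (fun q => (A q).im) p = (dρ A p).im := dρ_clm Complex.imCLM h

theorem dz_re {A : ℝ × ℝ → ℂ} {p : ℝ × ℝ} (h : DifferentiableAt ℝ A p) :
    dz (fun q => (A q).re) p = (dz A p).re := dz_clm Complex.reCLM h

theorem dρ_re {A : ℝ × ℝ → ℂ} {p : ℝ × ℝ} (h : DifferentiableAt ℝ A p) :
    dρ (fun q => (A q).re) p = (dρ A p).re := dρ_clm Complex.reCLM h

theorem dz_affine {A B : ℝ × ℝ → ℂ} {p : ℝ × ℝ} (c k : ℂ) (hA : DifferentiableAt ℝ A p)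
    (hB : DifferentiableAt ℝ B p) :
    dz (fun q => A q + c * B q + k) p = dz A p + c * dz B p := by
  rw [dz_add (by fun_prop) (by fun_prop), dz_add (by fun_prop) (by fun_prop),
    dz_const_mul _ hB, dz_const, add_zero]

theorem dρ_affine {A B : ℝ × ℝ → ℂ} {p : ℝ × ℝ} (c k : ℂ) (hA : DifferentiableAt ℝ A p)
    (hB : DifferentiableAt ℝ B p) :
    dρ (fun q => A q + c * B q + k) p = dρ A p + c * dρ B p := by
  rw [dρ_add (by fun_prop) (by fun_prop), dρ_add (by fun_prop) (by fun_prop),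
    dρ_const_mul _ hB, dρ_const, add_zero]

theorem eventually_differentiableAt {A : ℝ × ℝ → ℂ} {p : ℝ × ℝ}
    (hA : ContDiffAt ℝ (⊤ : ℕ∞) A p) : ∀ᶠ q in 𝓝 p, DifferentiableAt ℝ A q := by
  filter_upwards [(hA.of_le (m := 1) (by simp)).eventually (by simp)] with q hq
  exact hq.differentiableAt (by simp)

theorem dz_dz_affine {A B : ℝ × ℝ → ℂ} {p : ℝ × ℝ} (c k : ℂ)
    (hA : ContDiffAt ℝ (⊤ : ℕ∞) A p) (hB : ContDiffAt ℝ (⊤ : ℕ∞) B p) :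
    dz (dz (fun q => A q + c * B q + k)) p = dz (dz A) p + c * dz (dz B) p := by
  have : dz (fun q => A q + c * B q + k) =ᶠ[𝓝 p] fun q => dz A q + c * dz B q + 0 := by
    filter_upwards [eventually_differentiableAt hA, eventually_differentiableAt hB] with q h1 h2
    rw [dz_affine c k h1 h2, add_zero]
  rw [dz_congr this, dz_affine c 0 ((contDiffAt_dz hA).differentiableAt (by simp))
    ((contDiffAt_dz hB).differentiableAt (by simp))]

theorem dρ_dρ_affine {A B : ℝ × ℝ → ℂ} {p : ℝ × ℝ} (c k : ℂ)
    (hA : ContDiffAt ℝ (⊤ : ℕ∞) A p) (hB : ContDiffAt ℝ (⊤ : ℕ∞) B p) :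
    dρ (dρ (fun q => A q + c * B q + k)) p = dρ (dρ A) p + c * dρ (dρ B) p := by
  have : dρ (fun q => A q + c * B q + k) =ᶠ[𝓝 p] fun q => dρ A q + c * dρ B q + 0 := by
    filter_upwards [eventually_differentiableAt hA, eventually_differentiableAt hB] with q h1 h2
    rw [dρ_affine c k h1 h2, add_zero]
  rw [dρ_congr this, dρ_affine c 0 ((contDiffAt_dρ hA).differentiableAt (by simp))
    ((contDiffAt_dρ hB).differentiableAt (by simp))]

theorem laplacian_affine {A B : ℝ × ℝ → ℂ} {p : ℝ × ℝ} (c k : ℂ)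
    (hA : ContDiffAt ℝ (⊤ : ℕ∞) A p) (hB : ContDiffAt ℝ (⊤ : ℕ∞) B p) :
    laplacian (fun q => A q + c * B q + k) p = laplacian A p + c * laplacian B p := by
  rw [laplacian, laplacian, laplacian, dz_dz_affine c k hA hB, dρ_dρ_affine c k hA hB,
    dρ_affine c k (hA.differentiableAt (by simp)) (hB.differentiableAt (by simp))]
  ring

end Operations

theorem metricF_phase (E Φ : ℝ × ℝ → ℂ) {u : ℂ} (hu : u * conj u = 1) (p : ℝ × ℝ) :
    metricF E (fun q => u * Φ q) p = metricF E Φ p := by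
  have hn : ‖u‖ = 1 := by
    rw [Complex.mul_conj, Complex.normSq_eq_norm_sq] at hu
    exact (pow_eq_one_iff_of_nonneg (norm_nonneg u) two_ne_zero).1 (by exact_mod_cast hu)
  simp [metricF, hn]

theorem metricF_gauge (E Φ : ℝ × ℝ → ℂ) (a : ℂ) (b : ℝ) (p : ℝ × ℝ) :
    metricF (gaugeE a b E Φ) (gaugeΦ a Φ) p = metricF E Φ p := by
  simp only [metricF, gaugeE, gaugeΦ, ← Complex.normSq_eq_norm_sq, Complex.normSq_apply]
  simp [← Complex.ofReal_pow, ← Complex.normSq_eq_norm_sq, Complex.normSq_apply]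
  ring

variable {D : Set (ℝ × ℝ)} {E Φ : ℝ × ℝ → ℂ} {ω γ : ℝ × ℝ → ℝ}

namespace IsElectrovacSolution

theorem contDiffAt_E (h : IsElectrovacSolution D E Φ ω γ) {p : ℝ × ℝ} (hp : p ∈ D) :
    ContDiffAt ℝ (⊤ : ℕ∞) E p := h.smooth_E.contDiffAt (h.isOpen.mem_nhds hp)

theorem contDiffAt_Φ (h : IsElectrovacSolution D E Φ ω γ) {p : ℝ × ℝ} (hp : p ∈ D) :
    ContDiffAt ℝ (⊤ : ℕ∞) Φ p := h.smooth_Φ.contDiffAt (h.isOpen.mem_nhds hp)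

theorem differentiableAt_E (h : IsElectrovacSolution D E Φ ω γ) {p : ℝ × ℝ} (hp : p ∈ D) :
    DifferentiableAt ℝ E p := (h.contDiffAt_E hp).differentiableAt (by simp)

theorem differentiableAt_Φ (h : IsElectrovacSolution D E Φ ω γ) {p : ℝ × ℝ} (hp : p ∈ D) :
    DifferentiableAt ℝ Φ p := (h.contDiffAt_Φ hp).differentiableAt (by simp)

theorem dz_ω (h : IsElectrovacSolution D E Φ ω γ) {p : ℝ × ℝ} (hp : p ∈ D) :
    dz ω p = -(p.2 * (metricF E Φ p ^ 2)⁻¹ * (Gρ E Φ p).im) := by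
  rw [h.ω_z p hp, dρ_im (h.differentiableAt_E hp), Gρ, Complex.add_im, im_two_mul_mul]

theorem dρ_ω (h : IsElectrovacSolution D E Φ ω γ) {p : ℝ × ℝ} (hp : p ∈ D) :
    dρ ω p = p.2 * (metricF E Φ p ^ 2)⁻¹ * (Gz E Φ p).im := by
  rw [h.ω_ρ p hp, dz_im (h.differentiableAt_E hp), Gz, Complex.add_im, im_two_mul_mul]

/-- A pair of potentials whose `f` and `∇E + 2 Φ* ∇Φ` are those of a solution, and whose
electromagnetic potential has the gradient of that of the solution up to a phase, is again a
solution with the same metric functions. -/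
theorem of_same_metric (h : IsElectrovacSolution D E Φ ω γ) {E' Φ' : ℝ × ℝ → ℂ} {u a : ℂ}
    (hu : u * conj u = 1) (hE' : ∀ p ∈ D, ContDiffAt ℝ (⊤ : ℕ∞) E' p)
    (hΦ' : ∀ p ∈ D, ContDiffAt ℝ (⊤ : ℕ∞) Φ' p)
    (hf : ∀ p ∈ D, metricF E' Φ' p = metricF E Φ p)
    (hGz : ∀ p ∈ D, Gz E' Φ' p = Gz E Φ p) (hGρ : ∀ p ∈ D, Gρ E' Φ' p = Gρ E Φ p)
    (hEz : ∀ p ∈ D, dz E' p = dz E p + a * dz Φ p) (hEρ : ∀ p ∈ D, dρ E' p = dρ E p + a * dρ Φ p)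
    (hEl : ∀ p ∈ D, laplacian E' p = laplacian E p + a * laplacian Φ p)
    (hΦz : ∀ p ∈ D, dz Φ' p = u * dz Φ p) (hΦρ : ∀ p ∈ D, dρ Φ' p = u * dρ Φ p)
    (hΦl : ∀ p ∈ D, laplacian Φ' p = u * laplacian Φ p) :
    IsElectrovacSolution D E' Φ' ω γ where
  isOpen := h.isOpen
  isConnected := h.isConnected
  rho_pos := h.rho_pos
  smooth_E p hp := (hE' p hp).contDiffWithinAt
  smooth_Φ p hp := (hΦ' p hp).contDiffWithinAt
  f_ne_zero p hp := by rw [hf p hp]; exact h.f_ne_zero p hp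
  ernst_E p hp := by
    rw [hf p hp, hGz p hp, hGρ p hp, hEz p hp, hEρ p hp, hEl p hp]
    linear_combination h.ernst_E p hp + a * h.ernst_Φ p hp
  ernst_Φ p hp := by
    rw [hf p hp, hGz p hp, hGρ p hp, hΦz p hp, hΦρ p hp, hΦl p hp]
    linear_combination u * h.ernst_Φ p hp
  differentiable_ω := h.differentiable_ω
  differentiable_γ := h.differentiable_γ
  ω_z p hp := by
    rw [h.dz_ω hp, dρ_im ((hE' p hp).differentiableAt (by simp)), hf p hp, ← hGρ p hp, Gρ,
      Complex.add_im, im_two_mul_mul]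
  ω_ρ p hp := by
    rw [h.dρ_ω hp, dz_im ((hE' p hp).differentiableAt (by simp)), hf p hp, ← hGz p hp, Gz,
      Complex.add_im, im_two_mul_mul]
  γ_z p hp := by
    rw [h.γ_z p hp, hf p hp, hGz p hp, hGρ p hp, hΦz p hp, hΦρ p hp, map_mul, map_mul]
    linear_combination (p.2 : ℂ) * (metricF E Φ p : ℂ)⁻¹ *
      (dρ Φ p * conj (dz Φ p) + dz Φ p * conj (dρ Φ p)) * hu
  γ_ρ p hp := by
    rw [h.γ_ρ p hp, hf p hp, hGz p hp, hGρ p hp, hΦz p hp, hΦρ p hp, map_mul, map_mul]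
    linear_combination (p.2 : ℂ) * (metricF E Φ p : ℂ)⁻¹ *
      (dρ Φ p * conj (dρ Φ p) - dz Φ p * conj (dz Φ p)) * hu

theorem phase (h : IsElectrovacSolution D E Φ ω γ) {u : ℂ} (hu : u * conj u = 1) :
    IsElectrovacSolution D E (fun p => u * Φ p) ω γ := by
  have hz : ∀ p ∈ D, dz (fun p => u * Φ p) p = u * dz Φ p := fun p hp =>
    dz_const_mul _ (h.differentiableAt_Φ hp)
  have hρ : ∀ p ∈ D, dρ (fun p => u * Φ p) p = u * dρ Φ p := fun p hp =>
    dρ_const_mul _ (h.differentiableAt_Φ hp)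
  refine h.of_same_metric (a := 0) hu (fun p hp => h.contDiffAt_E hp)
    (fun p hp => contDiffAt_const.mul (h.contDiffAt_Φ hp))
    (fun p _ => metricF_phase E Φ hu p) (fun p hp => ?_) (fun p hp => ?_)
    (fun p _ => by simp) (fun p _ => by simp) (fun p _ => by simp) hz hρ (fun p hp => ?_)
  · rw [Gz, Gz, hz p hp, map_mul]
    linear_combination (2 * conj (Φ p) * dz Φ p) * hu
  · rw [Gρ, Gρ, hρ p hp, map_mul]
    linear_combination (2 * conj (Φ p) * dρ Φ p) * hu
  -- The product uΦ is treated as the affine combination 0 + uΦ + 0.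
  · simpa [laplacian, dz_const, dρ_const, show dz (fun _ : ℝ × ℝ => (0 : ℂ)) = fun _ => 0 from
      funext fun p => dz_const _, show dρ (fun _ : ℝ × ℝ => (0 : ℂ)) = fun _ => 0 from
      funext fun p => dρ_const _] using
      laplacian_affine u 0 (contDiffAt_const (c := 0)) (h.contDiffAt_Φ hp)

theorem gauge (h : IsElectrovacSolution D E Φ ω γ) (a : ℂ) (b : ℝ) :
    IsElectrovacSolution D (gaugeE a b E Φ) (gaugeΦ a Φ) ω γ := by
  have hE : gaugeE a b E Φ = fun q => E q + (-(2 * conj a)) * Φ q +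
      (-(‖a‖ : ℂ) ^ 2 + b * Complex.I) := by
    ext q; simp only [gaugeE]; ring
  have hΦ : gaugeΦ a Φ = fun q => Φ q + 0 * Φ q + a := by
    ext q; simp only [gaugeΦ]; ring
  have hEz : ∀ p ∈ D, dz (gaugeE a b E Φ) p = dz E p + (-(2 * conj a)) * dz Φ p := fun p hp => by
    rw [hE, dz_affine _ _ (h.differentiableAt_E hp) (h.differentiableAt_Φ hp)]
  have hEρ : ∀ p ∈ D, dρ (gaugeE a b E Φ) p = dρ E p + (-(2 * conj a)) * dρ Φ p := fun p hp => by
    rw [hE, dρ_affine _ _ (h.differentiableAt_E hp) (h.differentiableAt_Φ hp)]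
  have hΦz : ∀ p ∈ D, dz (gaugeΦ a Φ) p = 1 * dz Φ p := fun p hp => by
    rw [hΦ, dz_affine _ _ (h.differentiableAt_Φ hp) (h.differentiableAt_Φ hp)]; ring
  have hΦρ : ∀ p ∈ D, dρ (gaugeΦ a Φ) p = 1 * dρ Φ p := fun p hp => by
    rw [hΦ, dρ_affine _ _ (h.differentiableAt_Φ hp) (h.differentiableAt_Φ hp)]; ring
  refine h.of_same_metric (u := 1) (a := -(2 * conj a)) (by simp)
    (fun p hp => ?_) (fun p hp => (h.contDiffAt_Φ hp).add contDiffAt_const)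
    (fun p _ => metricF_gauge E Φ a b p) (fun p hp => ?_) (fun p hp => ?_)
    hEz hEρ (fun p hp => ?_) hΦz hΦρ (fun p hp => ?_)
  · rw [hE]
    exact ((h.contDiffAt_E hp).add (contDiffAt_const.mul (h.contDiffAt_Φ hp))).add contDiffAt_const
  · rw [Gz, Gz, hEz p hp, hΦz p hp, gaugeΦ, map_add]; ring
  · rw [Gρ, Gρ, hEρ p hp, hΦρ p hp, gaugeΦ, map_add]; ring
  · rw [hE, laplacian_affine _ _ (h.contDiffAt_E hp) (h.contDiffAt_Φ hp)]
  · rw [hΦ, laplacian_affine _ _ (h.contDiffAt_Φ hp) (h.contDiffAt_Φ hp)]; ring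

/-- All equations are conjugated; G becomes G*, and since ∇ω depends on Im G, the sign of ω changes.
-/
theorem conjugate (h : IsElectrovacSolution D E Φ ω γ) :
    IsElectrovacSolution D (fun p => conj (E p)) (fun p => conj (Φ p)) (fun p => -ω p) γ := by
  have hf : ∀ p, metricF (fun p => conj (E p)) (fun p => conj (Φ p)) p = metricF E Φ p :=
    fun p => by simp [metricF]
  have hGz : ∀ p, Gz (fun p => conj (E p)) (fun p => conj (Φ p)) p = conj (Gz E Φ p) :=
    fun p => by simp [Gz, dz_conj, map_ofNat]
  have hGρ : ∀ p, Gρ (fun p => conj (E p)) (fun p => conj (Φ p)) p = conj (Gρ E Φ p) :=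
    fun p => by simp [Gρ, dρ_conj, map_ofNat]
  have hl : ∀ A : ℝ × ℝ → ℂ, ∀ p, laplacian (fun p => conj (A p)) p = conj (laplacian A p) :=
    fun A p => by simp [laplacian, dz_conj, dρ_conj]
  have cE : ∀ p ∈ D, ContDiffAt ℝ (⊤ : ℕ∞) (fun p => conj (E p)) p := fun p hp =>
    Complex.conjCLE.contDiff.contDiffAt.comp p (h.contDiffAt_E hp)
  have cΦ : ∀ p ∈ D, ContDiffAt ℝ (⊤ : ℕ∞) (fun p => conj (Φ p)) p := fun p hp =>
    Complex.conjCLE.contDiff.contDiffAt.comp p (h.contDiffAt_Φ hp)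
  refine ⟨h.isOpen, h.isConnected, h.rho_pos, fun p hp => (cE p hp).contDiffWithinAt,
    fun p hp => (cΦ p hp).contDiffWithinAt, fun p hp => by rw [hf]; exact h.f_ne_zero p hp,
    fun p hp => ?_, fun p hp => ?_, h.differentiable_ω.neg, h.differentiable_γ,
    fun p hp => ?_, fun p hp => ?_, fun p hp => ?_, fun p hp => ?_⟩
  · have := congrArg conj (h.ernst_E p hp)
    rw [hf, hGz, hGρ, hl, dz_conj, dρ_conj]
    simpa using this
  · have := congrArg conj (h.ernst_Φ p hp)
    rw [hf, hGz, hGρ, hl, dz_conj, dρ_conj]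
    simpa using this
  · rw [dz_neg, h.dz_ω hp, hf, dρ_im ((cE p hp).differentiableAt (by simp)), dρ_conj, dρ_conj, Gρ]
    simp
    ring
  · rw [dρ_neg, h.dρ_ω hp, hf, dz_im ((cE p hp).differentiableAt (by simp)), dz_conj, dz_conj, Gz]
    simp
    ring
  · rw [h.γ_z p hp, hf, hGz, hGρ, dz_conj, dρ_conj]
    simp only [Complex.conj_conj]
    ring
  · rw [h.γ_ρ p hp, hf, hGz, hGρ, dz_conj, dρ_conj]
    simp only [Complex.conj_conj]
    ring

/-- Only z-derivatives change sign. Each equation for ω relates derivatives in different directions,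
so it survives exactly with the extra sign of ω; γ needs none. -/
theorem comp_reflect (h : IsElectrovacSolution D E Φ ω γ) {z₀ : ℝ}
    (hD : ∀ p ∈ D, reflect z₀ p ∈ D) :
    IsElectrovacSolution D (fun p => E (reflect z₀ p)) (fun p => Φ (reflect z₀ p))
      (fun p => -ω (reflect z₀ p)) (fun p => γ (reflect z₀ p)) := by
  have hf : ∀ p, metricF (fun p => E (reflect z₀ p)) (fun p => Φ (reflect z₀ p)) p
      = metricF E Φ (reflect z₀ p) := fun p => rfl
  have hGz : ∀ p, Gz (fun p => E (reflect z₀ p)) (fun p => Φ (reflect z₀ p)) p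
      = -Gz E Φ (reflect z₀ p) := fun p => by
    simp only [Gz, dz_comp_reflect]; ring
  have hGρ : ∀ p, Gρ (fun p => E (reflect z₀ p)) (fun p => Φ (reflect z₀ p)) p
      = Gρ E Φ (reflect z₀ p) := fun p => by
    simp only [Gρ, dρ_comp_reflect]
  have hl : ∀ A : ℝ × ℝ → ℂ, ∀ p, laplacian (fun p => A (reflect z₀ p)) p
      = laplacian A (reflect z₀ p) := fun A p => by
    rw [laplacian, dz_comp_reflect, dρ_comp_reflect, dρ_comp_reflect, dz_neg, dz_comp_reflect,
      neg_neg]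
    rfl
  have cE : ∀ p ∈ D, ContDiffAt ℝ (⊤ : ℕ∞) (fun p => E (reflect z₀ p)) p := fun p hp =>
    (h.contDiffAt_E (hD p hp)).comp p (contDiff_reflect z₀).contDiffAt
  have cΦ : ∀ p ∈ D, ContDiffAt ℝ (⊤ : ℕ∞) (fun p => Φ (reflect z₀ p)) p := fun p hp =>
    (h.contDiffAt_Φ (hD p hp)).comp p (contDiff_reflect z₀).contDiffAt
  have hr : ∀ p, (reflect z₀ p).2 = p.2 := fun p => rfl
  have hdiff : ∀ {A : ℝ × ℝ → ℝ}, DifferentiableOn ℝ A D →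
      DifferentiableOn ℝ (fun p => A (reflect z₀ p)) D := fun hA p hp =>
    ((differentiableAt_comp_reflect z₀ _ p).2
      (hA.differentiableAt (h.isOpen.mem_nhds (hD p hp)))).differentiableWithinAt
  refine ⟨h.isOpen, h.isConnected, h.rho_pos, fun p hp => (cE p hp).contDiffWithinAt,
    fun p hp => (cΦ p hp).contDiffWithinAt, fun p hp => h.f_ne_zero _ (hD p hp),
    fun p hp => ?_, fun p hp => ?_, (hdiff h.differentiable_ω).neg, hdiff h.differentiable_γ,
    fun p hp => ?_, fun p hp => ?_, fun p hp => ?_, fun p hp => ?_⟩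
  · rw [hf, hGz, hGρ, hl, dz_comp_reflect, dρ_comp_reflect]
    linear_combination h.ernst_E _ (hD p hp)
  · rw [hf, hGz, hGρ, hl, dz_comp_reflect, dρ_comp_reflect]
    linear_combination h.ernst_Φ _ (hD p hp)
  · have := h.ω_z _ (hD p hp)
    rw [hr] at this
    rw [dz_neg, dz_comp_reflect, hf, dρ_comp_reflect,
      dρ_comp_reflect (A := fun q => (E q).im), neg_neg, this]
  · have := h.ω_ρ _ (hD p hp)
    rw [hr] at this
    rw [dρ_neg, dρ_comp_reflect, hf, dz_comp_reflect,
      dz_comp_reflect (A := fun q => (E q).im)]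
    beta_reduce
    rw [this]
    simp
    ring
  · have := h.γ_z _ (hD p hp)
    rw [hr] at this
    rw [dz_comp_reflect, hf, hGz, hGρ, dz_comp_reflect, dρ_comp_reflect, Complex.ofReal_neg, this]
    simp only [map_neg]
    ring
  · have := h.γ_ρ _ (hD p hp)
    rw [hr] at this
    rw [dρ_comp_reflect, hf, hGz, hGρ, dz_comp_reflect, dρ_comp_reflect, this]
    simp only [map_neg]
    ring

end IsElectrovacSolution

end

/-! ### Unique continuation for complex functions, and what the metric determines -/

section

theorem gradSq_re_add_im {Ψ : ℝ × ℝ → ℂ} {p : ℝ × ℝ} (h : DifferentiableAt ℝ Ψ p) :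
    gradSq (fun q => (Ψ q).re) p + gradSq (fun q => (Ψ q).im) p
      = Complex.normSq (dz Ψ p) + Complex.normSq (dρ Ψ p) := by
  simp only [gradSq, dz_re h, dρ_re h, dz_im h, dρ_im h, Complex.normSq_apply]
  ring

theorem planarLaplacian_re_add_im {Ψ : ℝ × ℝ → ℂ} {p : ℝ × ℝ}
    (h : ContDiffAt ℝ (⊤ : ℕ∞) Ψ p) :
    planarLaplacian (fun q => (Ψ q).re) p ^ 2 + planarLaplacian (fun q => (Ψ q).im) p ^ 2
      = Complex.normSq (dz (dz Ψ) p + dρ (dρ Ψ) p) := by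
  have e1 : dz (fun q => (Ψ q).re) =ᶠ[𝓝 p] fun q => (dz Ψ q).re := by
    filter_upwards [eventually_differentiableAt h] with q hq using dz_re hq
  have e2 : dz (fun q => (Ψ q).im) =ᶠ[𝓝 p] fun q => (dz Ψ q).im := by
    filter_upwards [eventually_differentiableAt h] with q hq using dz_im hq
  have e3 : dρ (fun q => (Ψ q).re) =ᶠ[𝓝 p] fun q => (dρ Ψ q).re := by
    filter_upwards [eventually_differentiableAt h] with q hq using dρ_re hq
  have e4 : dρ (fun q => (Ψ q).im) =ᶠ[𝓝 p] fun q => (dρ Ψ q).im := by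
    filter_upwards [eventually_differentiableAt h] with q hq using dρ_im hq
  have d1 : DifferentiableAt ℝ (dz Ψ) p := (contDiffAt_dz h).differentiableAt (by simp)
  have d2 : DifferentiableAt ℝ (dρ Ψ) p := (contDiffAt_dρ h).differentiableAt (by simp)
  rw [planarLaplacian, planarLaplacian, dz_congr e1, dz_congr e2, dρ_congr e3, dρ_congr e4,
    dz_re d1, dz_im d1, dρ_re d2, dρ_im d2, Complex.normSq_apply, Complex.add_re, Complex.add_im]
  ring

/-- Weak unique continuation for gradients of solutions of linear second-order equations with the
Laplacian of the plane as principal part. -/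
theorem grad_eq_zero_of_unique_continuation {D V : Set (ℝ × ℝ)} {Ψ b₁ b₂ : ℝ × ℝ → ℂ}
    (hDo : IsOpen D) (hDc : IsPreconnected D)
    (hΨ : ∀ p ∈ D, ContDiffAt ℝ (⊤ : ℕ∞) Ψ p)
    (hb₁ : ContinuousOn b₁ D) (hb₂ : ContinuousOn b₂ D)
    (heq : ∀ p ∈ D, dz (dz Ψ) p + dρ (dρ Ψ) p = b₁ p * dz Ψ p + b₂ p * dρ Ψ p)
    (hV : IsOpen V) (hVne : (D ∩ V).Nonempty) (hVD : V ⊆ D)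
    (hz : ∀ p ∈ V, dz Ψ p = 0 ∧ dρ Ψ p = 0) :
    ∀ p ∈ D, dz Ψ p = 0 ∧ dρ Ψ p = 0 := by
  have hd : ∀ p ∈ D, DifferentiableAt ℝ Ψ p := fun p hp => (hΨ p hp).differentiableAt (by simp)
  intro p hp
  have key := gradSq_add_eq_zero_of_unique_continuation (D := D) (V := V)
    (g := fun q => (Ψ q).re) (h := fun q => (Ψ q).im)
    (m := fun q => 2 * (Complex.normSq (b₁ q) + Complex.normSq (b₂ q))) hDo hDc
    (fun p hp => Complex.reCLM.contDiff.contDiffAt.comp p (hΨ p hp))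
    (fun p hp => Complex.imCLM.contDiff.contDiffAt.comp p (hΨ p hp))
    (continuousOn_const.mul ((Complex.continuous_normSq.comp_continuousOn hb₁).add
      (Complex.continuous_normSq.comp_continuousOn hb₂))) (fun p hp => ?_) hV hVne
    (fun p hp => ?_) p hp
  · rw [gradSq_re_add_im (hd p hp)] at key
    have h1 := Complex.normSq_nonneg (dz Ψ p)
    have h2 := Complex.normSq_nonneg (dρ Ψ p)
    exact ⟨Complex.normSq_eq_zero.1 (by linarith), Complex.normSq_eq_zero.1 (by linarith)⟩
  · rw [gradSq_re_add_im (hd p hp), planarLaplacian_re_add_im (hΨ p hp), heq p hp]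
    -- Together with multiplicativity of the squared modulus this gives |b₁x + b₂y|² ≤ 2(|b₁|² +
    -- |b₂|²)(|x|² + |y|²).
    have h1 : Complex.normSq (b₁ p * dz Ψ p + b₂ p * dρ Ψ p) ≤
        2 * (Complex.normSq (b₁ p * dz Ψ p) + Complex.normSq (b₂ p * dρ Ψ p)) := by
      simp only [Complex.normSq_apply, Complex.add_re, Complex.add_im]
      nlinarith [sq_nonneg ((b₁ p * dz Ψ p).re - (b₂ p * dρ Ψ p).re),
        sq_nonneg ((b₁ p * dz Ψ p).im - (b₂ p * dρ Ψ p).im)]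
    rw [Complex.normSq_mul, Complex.normSq_mul] at h1
    nlinarith [mul_nonneg (Complex.normSq_nonneg (b₁ p)) (Complex.normSq_nonneg (dρ Ψ p)),
      mul_nonneg (Complex.normSq_nonneg (b₂ p)) (Complex.normSq_nonneg (dz Ψ p))]
  · rw [gradSq_re_add_im (hd p (hVD hp)), (hz p hp).1, (hz p hp).2]
    simp

theorem eqOn_const_of_dz_of_dρ {F : Type*} [NormedAddCommGroup F] [NormedSpace ℝ F]
    {D : Set (ℝ × ℝ)} (hDo : IsOpen D) (hDc : IsPreconnected D)
    {A : ℝ × ℝ → F} (hA : DifferentiableOn ℝ A D) (hz : ∀ p ∈ D, dz A p = 0)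
    (hρ : ∀ p ∈ D, dρ A p = 0) : ∃ c, ∀ p ∈ D, A p = c :=
  hDo.exists_is_const_of_fderiv_eq_zero hDc hA fun p hp =>
    fderiv_eq_zero_of_dz_of_dρ (hz p hp) (hρ p hp)

theorem differentiableAt_conj {A : ℝ × ℝ → ℂ} {p : ℝ × ℝ} (h : DifferentiableAt ℝ A p) :
    DifferentiableAt ℝ (fun q => conj (A q)) p :=
  Complex.conjCLE.differentiableAt.comp p h

theorem contDiffAt_conj {A : ℝ × ℝ → ℂ} {p : ℝ × ℝ} {n : WithTop ℕ∞} (h : ContDiffAt ℝ n A p) :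
    ContDiffAt ℝ n (fun q => conj (A q)) p :=
  Complex.conjCLE.contDiff.contDiffAt.comp p h

variable {D : Set (ℝ × ℝ)} {E Φ E₁ Φ₁ E₂ Φ₂ : ℝ × ℝ → ℂ} {ω γ ω₁ γ₁ ω₂ γ₂ : ℝ × ℝ → ℝ}

theorem metricF_eq_re (E Φ : ℝ × ℝ → ℂ) :
    metricF E Φ = fun q => (E q + conj (Φ q) * Φ q).re := by
  ext q
  rw [metricF, Complex.add_re, mul_comm, Complex.mul_conj, Complex.normSq_eq_norm_sq,
    Complex.ofReal_re]

namespace IsElectrovacSolution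

section Derivatives

variable (h : IsElectrovacSolution D E Φ ω γ) {p : ℝ × ℝ} (hp : p ∈ D)
include h hp

theorem dz_metricF : dz (metricF E Φ) p = (Gz E Φ p).re := by
  have hE := h.differentiableAt_E hp
  have hΦ := h.differentiableAt_Φ hp
  have hc := differentiableAt_conj hΦ
  rw [metricF_eq_re, dz_re (hE.fun_add (hc.fun_mul hΦ)), dz_add hE (hc.fun_mul hΦ), dz_mul hc hΦ, dz_conj, Gz]
  simp
  ring

theorem dρ_metricF : dρ (metricF E Φ) p = (Gρ E Φ p).re := by
  have hE := h.differentiableAt_E hp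
  have hΦ := h.differentiableAt_Φ hp
  have hc := differentiableAt_conj hΦ
  rw [metricF_eq_re, dρ_re (hE.fun_add (hc.fun_mul hΦ)), dρ_add hE (hc.fun_mul hΦ), dρ_mul hc hΦ, dρ_conj, Gρ]
  simp
  ring

theorem dz_Gz : dz (Gz E Φ) p
    = dz (dz E) p + 2 * (conj (Φ p) * dz (dz Φ) p + conj (dz Φ p) * dz Φ p) := by
  have hE := (contDiffAt_dz (h.contDiffAt_E hp)).differentiableAt (by simp)
  have hΦ := (contDiffAt_dz (h.contDiffAt_Φ hp)).differentiableAt (by simp)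
  have hc := differentiableAt_conj (h.differentiableAt_Φ hp)
  have : Gz E Φ = fun q => dz E q + 2 * (conj (Φ q) * dz Φ q) := by
    ext q; rw [Gz, mul_assoc]
  rw [this, dz_add hE ((hc.fun_mul hΦ).const_mul 2), dz_const_mul _ (hc.fun_mul hΦ), dz_mul hc hΦ, dz_conj]

theorem dρ_Gz : dρ (Gz E Φ) p
    = dρ (dz E) p + 2 * (conj (Φ p) * dρ (dz Φ) p + conj (dρ Φ p) * dz Φ p) := by
  have hE := (contDiffAt_dz (h.contDiffAt_E hp)).differentiableAt (by simp)
  have hΦ := (contDiffAt_dz (h.contDiffAt_Φ hp)).differentiableAt (by simp)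
  have hc := differentiableAt_conj (h.differentiableAt_Φ hp)
  have : Gz E Φ = fun q => dz E q + 2 * (conj (Φ q) * dz Φ q) := by
    ext q; rw [Gz, mul_assoc]
  rw [this, dρ_add hE ((hc.fun_mul hΦ).const_mul 2), dρ_const_mul _ (hc.fun_mul hΦ), dρ_mul hc hΦ, dρ_conj]

theorem dz_Gρ : dz (Gρ E Φ) p
    = dz (dρ E) p + 2 * (conj (Φ p) * dz (dρ Φ) p + conj (dz Φ p) * dρ Φ p) := by
  have hE := (contDiffAt_dρ (h.contDiffAt_E hp)).differentiableAt (by simp)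
  have hΦ := (contDiffAt_dρ (h.contDiffAt_Φ hp)).differentiableAt (by simp)
  have hc := differentiableAt_conj (h.differentiableAt_Φ hp)
  have : Gρ E Φ = fun q => dρ E q + 2 * (conj (Φ q) * dρ Φ q) := by
    ext q; rw [Gρ, mul_assoc]
  rw [this, dz_add hE ((hc.fun_mul hΦ).const_mul 2), dz_const_mul _ (hc.fun_mul hΦ), dz_mul hc hΦ, dz_conj]

theorem dρ_Gρ : dρ (Gρ E Φ) p
    = dρ (dρ E) p + 2 * (conj (Φ p) * dρ (dρ Φ) p + conj (dρ Φ p) * dρ Φ p) := by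
  have hE := (contDiffAt_dρ (h.contDiffAt_E hp)).differentiableAt (by simp)
  have hΦ := (contDiffAt_dρ (h.contDiffAt_Φ hp)).differentiableAt (by simp)
  have hc := differentiableAt_conj (h.differentiableAt_Φ hp)
  have : Gρ E Φ = fun q => dρ E q + 2 * (conj (Φ q) * dρ Φ q) := by
    ext q; rw [Gρ, mul_assoc]
  rw [this, dρ_add hE ((hc.fun_mul hΦ).const_mul 2), dρ_const_mul _ (hc.fun_mul hΦ), dρ_mul hc hΦ, dρ_conj]

/-- The divergence of `∇E + 2 Φ* ∇Φ`. -/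
theorem divergence_G : (metricF E Φ p : ℂ) *
      (dz (Gz E Φ) p + dρ (Gρ E Φ) p + (p.2 : ℂ)⁻¹ * Gρ E Φ p)
    = Gz E Φ p ^ 2 + Gρ E Φ p ^ 2
      + 2 * metricF E Φ p * (conj (dz Φ p) * dz Φ p + conj (dρ Φ p) * dρ Φ p) := by
  have h1 := h.ernst_E p hp
  have h2 := h.ernst_Φ p hp
  rw [h.dz_Gz hp, h.dρ_Gρ hp]
  rw [laplacian] at h1 h2
  have e1 : Gz E Φ p = dz E p + 2 * conj (Φ p) * dz Φ p := rfl
  have e2 : Gρ E Φ p = dρ E p + 2 * conj (Φ p) * dρ Φ p := rfl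
  linear_combination h1 + 2 * conj (Φ p) * h2 - Gz E Φ p * e1
    + (metricF E Φ p * (p.2 : ℂ)⁻¹ - Gρ E Φ p) * e2

/-- The curl of `∇E + 2 Φ* ∇Φ`. -/
theorem curl_G : dρ (Gz E Φ) p - dz (Gρ E Φ) p
    = 2 * (conj (dρ Φ p) * dz Φ p - conj (dz Φ p) * dρ Φ p) := by
  rw [h.dρ_Gz hp, h.dz_Gρ hp, dρ_dz_comm (h.contDiffAt_E hp), dρ_dz_comm (h.contDiffAt_Φ hp)]
  ring

end Derivatives

variable (h₁ : IsElectrovacSolution D E₁ Φ₁ ω₁ γ₁) (h₂ : IsElectrovacSolution D E₂ Φ₂ ω₂ γ₂)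
include h₁ h₂

/-- The real part of G is the gradient of f, and the equations for ω give its imaginary part because
ρ and f do not vanish. -/
theorem Gz_eq (hf : ∀ p ∈ D, metricF E₁ Φ₁ p = metricF E₂ Φ₂ p)
    (hω : ∀ p ∈ D, dρ ω₁ p = dρ ω₂ p) {p : ℝ × ℝ} (hp : p ∈ D) : Gz E₁ Φ₁ p = Gz E₂ Φ₂ p := by
  have e : metricF E₁ Φ₁ =ᶠ[𝓝 p] metricF E₂ Φ₂ := by
    filter_upwards [h₁.isOpen.mem_nhds hp] with q hq using hf q hq
  refine Complex.ext ?_ ?_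
  · rw [← h₁.dz_metricF hp, ← h₂.dz_metricF hp, dz_congr e]
  · have := hω p hp
    rw [h₁.dρ_ω hp, h₂.dρ_ω hp, hf p hp] at this
    exact mul_left_cancel₀ (mul_ne_zero (h₁.rho_pos p hp).ne'
      (inv_ne_zero (pow_ne_zero 2 (h₂.f_ne_zero p hp)))) this

theorem Gρ_eq (hf : ∀ p ∈ D, metricF E₁ Φ₁ p = metricF E₂ Φ₂ p)
    (hω : ∀ p ∈ D, dz ω₁ p = dz ω₂ p) {p : ℝ × ℝ} (hp : p ∈ D) : Gρ E₁ Φ₁ p = Gρ E₂ Φ₂ p := by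
  have e : metricF E₁ Φ₁ =ᶠ[𝓝 p] metricF E₂ Φ₂ := by
    filter_upwards [h₁.isOpen.mem_nhds hp] with q hq using hf q hq
  refine Complex.ext ?_ ?_
  · rw [← h₁.dρ_metricF hp, ← h₂.dρ_metricF hp, dρ_congr e]
  · have := hω p hp
    rw [h₁.dz_ω hp, h₂.dz_ω hp, hf p hp, neg_inj] at this
    exact mul_left_cancel₀ (mul_ne_zero (h₁.rho_pos p hp).ne'
      (inv_ne_zero (pow_ne_zero 2 (h₂.f_ne_zero p hp)))) this

/-- The metric determines the Hermitian Gram matrix of the gradient of `Φ`. -/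
theorem gram_eq (hf : ∀ p ∈ D, metricF E₁ Φ₁ p = metricF E₂ Φ₂ p)
    (hωz : ∀ p ∈ D, dz ω₁ p = dz ω₂ p) (hωρ : ∀ p ∈ D, dρ ω₁ p = dρ ω₂ p)
    (hγz : ∀ p ∈ D, dz γ₁ p = dz γ₂ p) (hγρ : ∀ p ∈ D, dρ γ₁ p = dρ γ₂ p)
    {p : ℝ × ℝ} (hp : p ∈ D) :
    dz Φ₁ p * conj (dz Φ₁ p) = dz Φ₂ p * conj (dz Φ₂ p) ∧
    dρ Φ₁ p * conj (dρ Φ₁ p) = dρ Φ₂ p * conj (dρ Φ₂ p) ∧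
    dz Φ₁ p * conj (dρ Φ₁ p) = dz Φ₂ p * conj (dρ Φ₂ p) ∧
    dρ Φ₁ p * conj (dz Φ₁ p) = dρ Φ₂ p * conj (dz Φ₂ p) := by
  have ez : Gz E₁ Φ₁ =ᶠ[𝓝 p] Gz E₂ Φ₂ := by
    filter_upwards [h₁.isOpen.mem_nhds hp] with q hq using h₁.Gz_eq h₂ hf hωρ hq
  have eρ : Gρ E₁ Φ₁ =ᶠ[𝓝 p] Gρ E₂ Φ₂ := by
    filter_upwards [h₁.isOpen.mem_nhds hp] with q hq using h₁.Gρ_eq h₂ hf hωz hq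
  have f0 : (metricF E₂ Φ₂ p : ℂ) ≠ 0 := Complex.ofReal_ne_zero.2 (h₂.f_ne_zero p hp)
  have r0 : (p.2 : ℂ) ≠ 0 := Complex.ofReal_ne_zero.2 (h₁.rho_pos p hp).ne'
  have hdiv := h₁.divergence_G hp
  rw [dz_congr ez, dρ_congr eρ, ez.eq_of_nhds, eρ.eq_of_nhds, hf p hp, h₂.divergence_G hp] at hdiv
  have hcurl := h₁.curl_G hp
  rw [dρ_congr ez, dz_congr eρ, h₂.curl_G hp] at hcurl
  have hz := h₁.γ_z p hp
  rw [hγz p hp, h₂.γ_z p hp, ez.eq_of_nhds, eρ.eq_of_nhds, hf p hp] at hz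
  have hρ := h₁.γ_ρ p hp
  rw [hγρ p hp, h₂.γ_ρ p hp, ez.eq_of_nhds, eρ.eq_of_nhds, hf p hp] at hρ
  have k0 : (p.2 : ℂ) * (metricF E₂ Φ₂ p : ℂ)⁻¹ ≠ 0 := mul_ne_zero r0 (inv_ne_zero f0)
  -- The terms in G agree, leaving four linear relations for the Gram matrix: its trace, the
  -- difference of the off-diagonal entries, their sum, and the difference of the diagonal entries.
  have hdiv' := mul_left_cancel₀ (mul_ne_zero two_ne_zero f0) (add_left_cancel hdiv)
  have hcurl' := mul_left_cancel₀ (two_ne_zero' ℂ) hcurl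
  have hz' := mul_left_cancel₀ k0 (sub_right_inj.1 hz)
  have hρ' := mul_left_cancel₀ k0 (sub_right_inj.1 hρ)
  refine ⟨?_, ?_, ?_, ?_⟩
  · linear_combination (-hdiv' + hρ') / 2
  · linear_combination (-hdiv' - hρ') / 2
  · linear_combination (-hcurl' - hz') / 2
  · linear_combination (hcurl' - hz') / 2

end IsElectrovacSolution

end

/-! ### The constant phase, and potentials with the same metric -/

section

/-- The linear system for (x, y) has determinant ±(α² + β²), so this vanishes. As α and β are
imaginary, α² + β² = -(|α|² + |β|²). It is used with (α, β) = U*∇U and (x, y) = ∇Φ₂. -/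
theorem eq_zero_of_conj_eq_neg {α β x y : ℂ} (hα : α + conj α = 0) (hβ : β + conj β = 0)
    (h1 : β * x = α * y) (h2 : α * x + β * y = 0)
    (hxy : x * conj x + y * conj y ≠ 0) : α = 0 ∧ β = 0 := by
  have hx : (α ^ 2 + β ^ 2) * x = 0 := by linear_combination α * h2 + β * h1
  have hy : (α ^ 2 + β ^ 2) * y = 0 := by linear_combination β * h2 - α * h1
  have hs : α ^ 2 + β ^ 2 = 0 := by
    by_contra hne
    have hx0 := (mul_eq_zero.1 hx).resolve_left hne
    have hy0 := (mul_eq_zero.1 hy).resolve_left hne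
    exact hxy (by simp [hx0, hy0])
  have hn : α * conj α + β * conj β = 0 := by linear_combination α * hα + β * hβ - hs
  rw [Complex.mul_conj, Complex.mul_conj, ← Complex.ofReal_add, Complex.ofReal_eq_zero] at hn
  have := Complex.normSq_nonneg α
  have := Complex.normSq_nonneg β
  exact ⟨Complex.normSq_eq_zero.1 (by linarith), Complex.normSq_eq_zero.1 (by linarith)⟩

theorem mul_conj_add_mul_conj_eq_zero {x y : ℂ} :
    x * conj x + y * conj y = 0 ↔ x = 0 ∧ y = 0 := by
  refine ⟨fun h => ?_, fun h => by simp [h.1, h.2]⟩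
  rw [Complex.mul_conj, Complex.mul_conj, ← Complex.ofReal_add, Complex.ofReal_eq_zero] at h
  have := Complex.normSq_nonneg x
  have := Complex.normSq_nonneg y
  exact ⟨Complex.normSq_eq_zero.1 (by linarith), Complex.normSq_eq_zero.1 (by linarith)⟩

variable {D : Set (ℝ × ℝ)} {E₁ Φ₁ E₂ Φ₂ : ℝ × ℝ → ℂ} {ω₁ γ₁ ω₂ γ₂ : ℝ × ℝ → ℝ}

namespace IsElectrovacSolution

/-- Where the gradient of `Φ` does not vanish, two electromagnetic potentials of one metric have
locally the same gradient up to a constant phase. -/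
theorem exists_local_phase (h₁ : IsElectrovacSolution D E₁ Φ₁ ω₁ γ₁)
    (h₂ : IsElectrovacSolution D E₂ Φ₂ ω₂ γ₂)
    (hf : ∀ p ∈ D, metricF E₁ Φ₁ p = metricF E₂ Φ₂ p)
    (hωz : ∀ p ∈ D, dz ω₁ p = dz ω₂ p) (hωρ : ∀ p ∈ D, dρ ω₁ p = dρ ω₂ p)
    (hγz : ∀ p ∈ D, dz γ₁ p = dz γ₂ p) (hγρ : ∀ p ∈ D, dρ γ₁ p = dρ γ₂ p)
    {p₀ : ℝ × ℝ} (hp₀ : p₀ ∈ D) (hne : ¬(dz Φ₂ p₀ = 0 ∧ dρ Φ₂ p₀ = 0)) :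
    ∃ u : ℂ, u * conj u = 1 ∧ ∃ V ⊆ D, IsOpen V ∧ p₀ ∈ V ∧
      ∀ p ∈ V, dz Φ₁ p = u * dz Φ₂ p ∧ dρ Φ₁ p = u * dρ Φ₂ p := by
  set S : ℝ × ℝ → ℂ := fun p => dz Φ₂ p * conj (dz Φ₂ p) + dρ Φ₂ p * conj (dρ Φ₂ p) with hS
  set T : ℝ × ℝ → ℂ := fun p => dz Φ₁ p * conj (dz Φ₂ p) + dρ Φ₁ p * conj (dρ Φ₂ p) with hT
  -- The projection coefficient of ∇Φ₁ on ∇Φ₂. Equal Gram matrices make the two gradients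
  -- proportional with a factor of modulus 1, and this formula shows the factor to be
  -- differentiable.
  set U : ℝ × ℝ → ℂ := fun p => T p * (S p)⁻¹ with hU
  have z1 : ∀ p ∈ D, ContDiffAt ℝ (⊤ : ℕ∞) (dz Φ₁) p := fun p hp => contDiffAt_dz (h₁.contDiffAt_Φ hp)
  have r1 : ∀ p ∈ D, ContDiffAt ℝ (⊤ : ℕ∞) (dρ Φ₁) p := fun p hp => contDiffAt_dρ (h₁.contDiffAt_Φ hp)
  have z2 : ∀ p ∈ D, ContDiffAt ℝ (⊤ : ℕ∞) (dz Φ₂) p := fun p hp => contDiffAt_dz (h₂.contDiffAt_Φ hp)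
  have r2 : ∀ p ∈ D, ContDiffAt ℝ (⊤ : ℕ∞) (dρ Φ₂) p := fun p hp => contDiffAt_dρ (h₂.contDiffAt_Φ hp)
  have sS : ∀ p ∈ D, ContDiffAt ℝ (⊤ : ℕ∞) S p := fun p hp =>
    ((z2 p hp).mul (contDiffAt_conj (z2 p hp))).add ((r2 p hp).mul (contDiffAt_conj (r2 p hp)))
  have sT : ∀ p ∈ D, ContDiffAt ℝ (⊤ : ℕ∞) T p := fun p hp =>
    ((z1 p hp).mul (contDiffAt_conj (z2 p hp))).add ((r1 p hp).mul (contDiffAt_conj (r2 p hp)))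
  have hS₀ : S p₀ ≠ 0 := fun h => hne (mul_conj_add_mul_conj_eq_zero.1 h)
  have hnear : ∀ᶠ p in 𝓝 p₀, p ∈ D ∧ S p ≠ 0 :=
    (h₁.isOpen.eventually_mem hp₀).and ((sS p₀ hp₀).continuousAt.eventually_ne hS₀)
  obtain ⟨ε, ε0, hε⟩ := Metric.eventually_nhds_iff_ball.1 hnear
  set V := Metric.ball p₀ ε
  have hVo : IsOpen V := Metric.isOpen_ball
  have dU : ∀ p ∈ V, DifferentiableAt ℝ U p := fun p hp =>
    ((sT p (hε p hp).1).differentiableAt (by simp)).mul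
      (((sS p (hε p hp).1).differentiableAt (by simp)).inv (hε p hp).2)
  have Uz : ∀ p ∈ V, dz Φ₁ p = U p * dz Φ₂ p := by
    intro p hp
    obtain ⟨g1, g2, g3, g4⟩ := h₁.gram_eq h₂ hf hωz hωρ hγz hγρ (hε p hp).1
    have hS0 := (hε p hp).2
    have e : T p * dz Φ₂ p = dz Φ₁ p * S p := by
      simp only [hT, hS]
      linear_combination dz Φ₁ p * g2 - dρ Φ₁ p * g3
    rw [hU]
    field_simp
    linear_combination -e
  have Uρ : ∀ p ∈ V, dρ Φ₁ p = U p * dρ Φ₂ p := by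
    intro p hp
    obtain ⟨g1, g2, g3, g4⟩ := h₁.gram_eq h₂ hf hωz hωρ hγz hγρ (hε p hp).1
    have hS0 := (hε p hp).2
    have e : T p * dρ Φ₂ p = dρ Φ₁ p * S p := by
      simp only [hT, hS]
      linear_combination dρ Φ₁ p * g1 - dz Φ₁ p * g4
    rw [hU]
    field_simp
    linear_combination -e
  have Un : ∀ p ∈ V, U p * conj (U p) = 1 := by
    intro p hp
    obtain ⟨g1, g2, -, -⟩ := h₁.gram_eq h₂ hf hωz hωρ hγz hγρ (hε p hp).1
    rw [Uz p hp, map_mul] at g1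
    rw [Uρ p hp, map_mul] at g2
    refine mul_right_cancel₀ (hε p hp).2 ?_
    simp only [hS]
    linear_combination g1 + g2
  clear_value U
  -- Equal mixed derivatives of Φ₁ give U_ρ Φ₂_z = U_z Φ₂_ρ, the two Ernst equations give ∇U·∇Φ₂ =
  -- 0, and |U| = 1 makes U*∇U imaginary.
  have key : ∀ p ∈ V, dz U p = 0 ∧ dρ U p = 0 := by
    intro p hp
    have hpD := (hε p hp).1
    have ez : dz Φ₁ =ᶠ[𝓝 p] fun q => U q * dz Φ₂ q := by
      filter_upwards [hVo.mem_nhds hp] with q hq using Uz q hq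
    have eρ : dρ Φ₁ =ᶠ[𝓝 p] fun q => U q * dρ Φ₂ q := by
      filter_upwards [hVo.mem_nhds hp] with q hq using Uρ q hq
    have en : (fun q => U q * conj (U q)) =ᶠ[𝓝 p] fun _ => 1 := by
      filter_upwards [hVo.mem_nhds hp] with q hq using Un q hq
    have d1 := (z2 p hpD).differentiableAt (by simp)
    have d2 := (r2 p hpD).differentiableAt (by simp)
    have dc := differentiableAt_conj (dU p hp)
    have nz := dz_congr en
    rw [dz_const, dz_mul (dU p hp) dc, dz_conj] at nz
    have nρ := dρ_congr en
    rw [dρ_const, dρ_mul (dU p hp) dc, dρ_conj] at nρ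
    beta_reduce at nz nρ
    have hmix := dρ_dz_comm (h₁.contDiffAt_Φ hpD)
    rw [dρ_congr ez, dz_congr eρ, dρ_mul (dU p hp) d1, dz_mul (dU p hp) d2,
      dρ_dz_comm (h₂.contDiffAt_Φ hpD)] at hmix
    have hl := h₁.ernst_Φ p hpD
    rw [laplacian, h₁.Gz_eq h₂ hf hωρ hpD, h₁.Gρ_eq h₂ hf hωz hpD, hf p hpD, dz_congr ez,
      dρ_congr eρ, dz_mul (dU p hp) d1, dρ_mul (dU p hp) d2, Uz p hp, Uρ p hp] at hl
    have hl2 := h₂.ernst_Φ p hpD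
    rw [laplacian] at hl2
    have f0 : (metricF E₂ Φ₂ p : ℂ) ≠ 0 := Complex.ofReal_ne_zero.2 (h₂.f_ne_zero p hpD)
    have hl3 : dz U p * dz Φ₂ p + dρ U p * dρ Φ₂ p = 0 := by
      refine mul_left_cancel₀ f0 ?_
      linear_combination hl - U p * hl2
    have hcU : conj (U p) ≠ 0 := fun h0 => by
      have := Un p hp
      rw [h0, mul_zero] at this
      exact zero_ne_one this
    obtain ⟨ha, hb⟩ := eq_zero_of_conj_eq_neg (α := dz U p * conj (U p))
      (β := dρ U p * conj (U p)) (x := dz Φ₂ p) (y := dρ Φ₂ p)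
      (by rw [map_mul, Complex.conj_conj]; linear_combination nz)
      (by rw [map_mul, Complex.conj_conj]; linear_combination nρ)
      (by linear_combination conj (U p) * hmix)
      (by linear_combination conj (U p) * hl3) (hε p hp).2
    exact ⟨(mul_eq_zero.1 ha).resolve_right hcU, (mul_eq_zero.1 hb).resolve_right hcU⟩
  obtain ⟨u, hu⟩ := eqOn_const_of_dz_of_dρ hVo (convex_ball p₀ ε).isPreconnected
    (fun p hp => (dU p hp).differentiableWithinAt) (fun p hp => (key p hp).1)
    (fun p hp => (key p hp).2)
  have hp₀V : p₀ ∈ V := Metric.mem_ball_self ε0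
  refine ⟨u, ?_, V, fun p hp => (hε p hp).1, hVo, hp₀V, fun p hp => ?_⟩
  · rw [← hu p₀ hp₀V]
    exact Un p₀ hp₀V
  · rw [← hu p hp]
    exact ⟨Uz p hp, Uρ p hp⟩

/-- A phase found near one point is valid on all of D, across possible zeros of ∇Φ₂, by unique
continuation for Φ₁ - uΦ₂. If ∇Φ₂ vanishes identically, so does ∇Φ₁, and any phase will do. -/
theorem exists_phase (h₁ : IsElectrovacSolution D E₁ Φ₁ ω₁ γ₁)
    (h₂ : IsElectrovacSolution D E₂ Φ₂ ω₂ γ₂)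
    (hf : ∀ p ∈ D, metricF E₁ Φ₁ p = metricF E₂ Φ₂ p)
    (hωz : ∀ p ∈ D, dz ω₁ p = dz ω₂ p) (hωρ : ∀ p ∈ D, dρ ω₁ p = dρ ω₂ p)
    (hγz : ∀ p ∈ D, dz γ₁ p = dz γ₂ p) (hγρ : ∀ p ∈ D, dρ γ₁ p = dρ γ₂ p) :
    ∃ u : ℂ, u * conj u = 1 ∧ ∀ p ∈ D, dz Φ₁ p = u * dz Φ₂ p ∧ dρ Φ₁ p = u * dρ Φ₂ p := by
  by_cases hall : ∀ p ∈ D, dz Φ₂ p = 0 ∧ dρ Φ₂ p = 0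
  · refine ⟨1, by simp, fun p hp => ?_⟩
    obtain ⟨g1, g2, -, -⟩ := h₁.gram_eq h₂ hf hωz hωρ hγz hγρ hp
    obtain ⟨hz, hρ⟩ := hall p hp
    obtain ⟨k1, k2⟩ := mul_conj_add_mul_conj_eq_zero.1
      (show dz Φ₁ p * conj (dz Φ₁ p) + dρ Φ₁ p * conj (dρ Φ₁ p) = 0 by
        rw [g1, g2, hz, hρ]; simp)
    simp [hz, hρ, k1, k2]
  · push Not at hall
    obtain ⟨p₀, hp₀, hne⟩ := hall
    obtain ⟨u, hu, V, hVD, hVo, hp₀V, hV⟩ :=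
      h₁.exists_local_phase h₂ hf hωz hωρ hγz hγρ hp₀ (fun h => hne h.1 h.2)
    refine ⟨u, hu, fun p hp => ?_⟩
    have gz : ∀ p ∈ D, dz (fun q => Φ₁ q + (-u) * Φ₂ q + 0) p = dz Φ₁ p + (-u) * dz Φ₂ p :=
      fun p hp => dz_affine _ _ (h₁.differentiableAt_Φ hp) (h₂.differentiableAt_Φ hp)
    have gρ : ∀ p ∈ D, dρ (fun q => Φ₁ q + (-u) * Φ₂ q + 0) p = dρ Φ₁ p + (-u) * dρ Φ₂ p :=
      fun p hp => dρ_affine _ _ (h₁.differentiableAt_Φ hp) (h₂.differentiableAt_Φ hp)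
    have cf : ∀ p ∈ D, ContinuousAt (fun p => (metricF E₂ Φ₂ p : ℂ)⁻¹) p := fun p hp => by
      have c1 := (h₂.differentiableAt_E hp).continuousAt
      have c2 := (h₂.differentiableAt_Φ hp).continuousAt
      refine ContinuousAt.inv₀ (Complex.continuous_ofReal.continuousAt.comp ?_)
        (Complex.ofReal_ne_zero.2 (h₂.f_ne_zero p hp))
      exact (Complex.continuous_re.continuousAt.comp c1).add (c2.norm.pow 2)
    have cc : ∀ p ∈ D, ContinuousAt (fun p => conj (Φ₂ p)) p := fun p hp =>
      (differentiableAt_conj (h₂.differentiableAt_Φ hp)).continuousAt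
    have cGz : ∀ p ∈ D, ContinuousAt (Gz E₂ Φ₂) p := fun p hp =>
      (contDiffAt_dz (h₂.contDiffAt_E hp)).continuousAt.add
        ((continuousAt_const.mul (cc p hp)).mul (contDiffAt_dz (h₂.contDiffAt_Φ hp)).continuousAt)
    have cGρ : ∀ p ∈ D, ContinuousAt (Gρ E₂ Φ₂) p := fun p hp =>
      (contDiffAt_dρ (h₂.contDiffAt_E hp)).continuousAt.add
        ((continuousAt_const.mul (cc p hp)).mul (contDiffAt_dρ (h₂.contDiffAt_Φ hp)).continuousAt)
    have cρ : ∀ p ∈ D, ContinuousAt (fun p : ℝ × ℝ => (p.2 : ℂ)⁻¹) p := fun p hp =>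
      ContinuousAt.inv₀ (by fun_prop) (Complex.ofReal_ne_zero.2 (h₂.rho_pos p hp).ne')
    -- The Ernst equations of Φ₁ and Φ₂ share f and G, so they are one linear equation; the term
    -- ρ⁻¹∂_ρ of the Laplacian is moved into `b₂`.
    have := grad_eq_zero_of_unique_continuation (D := D) (V := V)
      (Ψ := fun q => Φ₁ q + (-u) * Φ₂ q + 0)
      (b₁ := fun q => Gz E₂ Φ₂ q * (metricF E₂ Φ₂ q : ℂ)⁻¹)
      (b₂ := fun q => Gρ E₂ Φ₂ q * (metricF E₂ Φ₂ q : ℂ)⁻¹ - (q.2 : ℂ)⁻¹)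
      h₁.isOpen h₁.isConnected.isPreconnected
      (fun p hp => ((h₁.contDiffAt_Φ hp).add (contDiffAt_const.mul (h₂.contDiffAt_Φ hp))).add
        contDiffAt_const)
      (fun p hp => ((cGz p hp).mul (cf p hp)).continuousWithinAt)
      (fun p hp => (((cGρ p hp).mul (cf p hp)).sub (cρ p hp)).continuousWithinAt)
      (fun p hp => ?_) hVo ⟨p₀, hp₀, hp₀V⟩ hVD (fun p hp => ?_) p hp
    · rw [gz p hp, gρ p hp] at this
      exact ⟨by linear_combination this.1, by linear_combination this.2⟩
    · rw [gz p hp, gρ p hp, dz_dz_affine _ _ (h₁.contDiffAt_Φ hp) (h₂.contDiffAt_Φ hp),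
        dρ_dρ_affine _ _ (h₁.contDiffAt_Φ hp) (h₂.contDiffAt_Φ hp)]
      have hl1 := h₁.ernst_Φ p hp
      rw [laplacian, h₁.Gz_eq h₂ hf hωρ hp, h₁.Gρ_eq h₂ hf hωz hp, hf p hp] at hl1
      have hl2 := h₂.ernst_Φ p hp
      rw [laplacian] at hl2
      have f0 : (metricF E₂ Φ₂ p : ℂ) ≠ 0 := Complex.ofReal_ne_zero.2 (h₂.f_ne_zero p hp)
      have hfi := mul_inv_cancel₀ f0
      linear_combination (metricF E₂ Φ₂ p : ℂ)⁻¹ * (hl1 - u * hl2)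
        - (dz (dz Φ₁) p + dρ (dρ Φ₁) p + (p.2 : ℂ)⁻¹ * dρ Φ₁ p
          - u * (dz (dz Φ₂) p + dρ (dρ Φ₂) p + (p.2 : ℂ)⁻¹ * dρ Φ₂ p)) * hfi
    · rw [gz p (hVD hp), gρ p (hVD hp), (hV p hp).1, (hV p hp).2]
      exact ⟨by ring, by ring⟩

/-- The metric determines the potentials up to the additive constants and a constant phase of
the electromagnetic potential. -/
theorem exists_gauge_of_same_metric (h₁ : IsElectrovacSolution D E₁ Φ₁ ω₁ γ₁)
    (h₂ : IsElectrovacSolution D E₂ Φ₂ ω₂ γ₂)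
    (hf : ∀ p ∈ D, metricF E₁ Φ₁ p = metricF E₂ Φ₂ p)
    {c₁ c₂ : ℝ} (hω : ∀ p ∈ D, ω₁ p = ω₂ p + c₁) (hγ : ∀ p ∈ D, γ₁ p = γ₂ p + c₂) :
    ∃ (u a : ℂ) (b : ℝ), u * conj u = 1 ∧ ∀ p ∈ D, Φ₁ p = u * Φ₂ p + a ∧
      E₁ p = gaugeE a b E₂ (fun q => u * Φ₂ q) p := by
  have hnhds : ∀ {A B : ℝ × ℝ → ℝ} {c : ℝ}, (∀ p ∈ D, A p = B p + c) → ∀ p ∈ D,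
      A =ᶠ[𝓝 p] fun q => B q + c := fun hAB p hp => by
    filter_upwards [h₁.isOpen.mem_nhds hp] with q hq using hAB q hq
  have dω : ∀ p ∈ D, DifferentiableAt ℝ ω₂ p := fun p hp =>
    h₂.differentiable_ω.differentiableAt (h₂.isOpen.mem_nhds hp)
  have dγ : ∀ p ∈ D, DifferentiableAt ℝ γ₂ p := fun p hp =>
    h₂.differentiable_γ.differentiableAt (h₂.isOpen.mem_nhds hp)
  have hωz : ∀ p ∈ D, dz ω₁ p = dz ω₂ p := fun p hp => by
    rw [dz_congr (hnhds hω p hp), dz_add (dω p hp) (by fun_prop), dz_const, add_zero]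
  have hωρ : ∀ p ∈ D, dρ ω₁ p = dρ ω₂ p := fun p hp => by
    rw [dρ_congr (hnhds hω p hp), dρ_add (dω p hp) (by fun_prop), dρ_const, add_zero]
  have hγz : ∀ p ∈ D, dz γ₁ p = dz γ₂ p := fun p hp => by
    rw [dz_congr (hnhds hγ p hp), dz_add (dγ p hp) (by fun_prop), dz_const, add_zero]
  have hγρ : ∀ p ∈ D, dρ γ₁ p = dρ γ₂ p := fun p hp => by
    rw [dρ_congr (hnhds hγ p hp), dρ_add (dγ p hp) (by fun_prop), dρ_const, add_zero]
  obtain ⟨u, hu, hgrad⟩ := h₁.exists_phase h₂ hf hωz hωρ hγz hγρ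
  have hDp := h₁.isConnected.isPreconnected
  have h₃ := h₂.phase hu
  obtain ⟨a, ha⟩ := eqOn_const_of_dz_of_dρ h₁.isOpen hDp (A := fun q => Φ₁ q - u * Φ₂ q)
    (fun p hp => ((h₁.differentiableAt_Φ hp).sub
      (h₃.differentiableAt_Φ hp)).differentiableWithinAt)
    (fun p hp => by
      rw [dz_sub (h₁.differentiableAt_Φ hp) (h₃.differentiableAt_Φ hp),
        dz_const_mul _ (h₂.differentiableAt_Φ hp), (hgrad p hp).1, sub_self])
    (fun p hp => by
      rw [dρ_sub (h₁.differentiableAt_Φ hp) (h₃.differentiableAt_Φ hp),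
        dρ_const_mul _ (h₂.differentiableAt_Φ hp), (hgrad p hp).2, sub_self])
  have hΦ : ∀ p ∈ D, Φ₁ p = u * Φ₂ p + a := fun p hp => by rw [← ha p hp]; ring
  -- After this change of constants the second solution has the same Φ as the first; equality of G
  -- then becomes equality of ∇E.
  have h₄ := h₃.gauge a 0
  have hf₄ : ∀ p ∈ D, metricF E₁ Φ₁ p = metricF (gaugeE a 0 E₂ fun q => u * Φ₂ q)
      (gaugeΦ a fun q => u * Φ₂ q) p := fun p hp => by
    rw [metricF_gauge, metricF_phase _ _ hu, hf p hp]
  have hΦ₄ : ∀ p ∈ D, Φ₁ =ᶠ[𝓝 p] gaugeΦ a fun q => u * Φ₂ q := fun p hp => by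
    filter_upwards [h₁.isOpen.mem_nhds hp] with q hq using hΦ q hq
  have hE := eqOn_const_of_dz_of_dρ h₁.isOpen hDp
    (A := fun q => E₁ q - gaugeE a 0 E₂ (fun q => u * Φ₂ q) q)
    (fun p hp => ((h₁.differentiableAt_E hp).sub
      (h₄.differentiableAt_E hp)).differentiableWithinAt)
    (fun p hp => by
      have := h₁.Gz_eq h₄ hf₄ hωρ hp
      rw [Gz, Gz, dz_congr (hΦ₄ p hp), (hΦ₄ p hp).eq_of_nhds] at this
      rw [dz_sub (h₁.differentiableAt_E hp) (h₄.differentiableAt_E hp), sub_eq_zero]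
      exact add_right_cancel this)
    (fun p hp => by
      have := h₁.Gρ_eq h₄ hf₄ hωz hp
      rw [Gρ, Gρ, dρ_congr (hΦ₄ p hp), (hΦ₄ p hp).eq_of_nhds] at this
      rw [dρ_sub (h₁.differentiableAt_E hp) (h₄.differentiableAt_E hp), sub_eq_zero]
      exact add_right_cancel this)
  obtain ⟨k, hk⟩ := hE
  refine ⟨u, a, k.im, hu, fun p hp => ⟨hΦ p hp, ?_⟩⟩
  -- Equal f and equal Φ leave no room for a real constant in E.
  have hre : k.re = 0 := by
    have := hf₄ p hp
    rw [metricF, metricF, (hΦ₄ p hp).eq_of_nhds] at this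
    rw [← hk p hp, Complex.sub_re, sub_eq_zero]
    exact add_right_cancel this
  have hkI : k = k.im * Complex.I := by
    apply Complex.ext <;> simp [hre]
  have := hk p hp
  rw [hkI] at this
  simp only [gaugeE, Complex.ofReal_zero] at this ⊢
  linear_combination this

/-- The metric functions `ω` and `γ` of given potentials are unique up to additive constants. -/
theorem exists_const_of_eqOn (h₁ : IsElectrovacSolution D E₁ Φ₁ ω₁ γ₁)
    (h₂ : IsElectrovacSolution D E₂ Φ₂ ω₂ γ₂) (hE : Set.EqOn E₁ E₂ D) (hΦ : Set.EqOn Φ₁ Φ₂ D) :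
    ∃ c₁ c₂ : ℝ, ∀ p ∈ D, ω₁ p = ω₂ p + c₁ ∧ γ₁ p = γ₂ p + c₂ := by
  have eE : ∀ p ∈ D, E₁ =ᶠ[𝓝 p] E₂ := fun p hp => hE.eventuallyEq_of_mem (h₁.isOpen.mem_nhds hp)
  have eΦ : ∀ p ∈ D, Φ₁ =ᶠ[𝓝 p] Φ₂ := fun p hp => hΦ.eventuallyEq_of_mem (h₁.isOpen.mem_nhds hp)
  have hf : ∀ p ∈ D, metricF E₁ Φ₁ p = metricF E₂ Φ₂ p := fun p hp => by
    rw [metricF, metricF, hE hp, hΦ hp]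
  have hGz : ∀ p ∈ D, Gz E₁ Φ₁ p = Gz E₂ Φ₂ p := fun p hp => by
    rw [Gz, Gz, dz_congr (eE p hp), dz_congr (eΦ p hp), hΦ hp]
  have hGρ : ∀ p ∈ D, Gρ E₁ Φ₁ p = Gρ E₂ Φ₂ p := fun p hp => by
    rw [Gρ, Gρ, dρ_congr (eE p hp), dρ_congr (eΦ p hp), hΦ hp]
  have dAt : ∀ {A : ℝ × ℝ → ℝ}, DifferentiableOn ℝ A D → ∀ p ∈ D, DifferentiableAt ℝ A p :=
    fun hA p hp => hA.differentiableAt (h₁.isOpen.mem_nhds hp)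
  obtain ⟨c₁, hc₁⟩ := eqOn_const_of_dz_of_dρ h₁.isOpen h₁.isConnected.isPreconnected
    (h₁.differentiable_ω.fun_sub h₂.differentiable_ω)
    (fun p hp => by
      rw [dz_sub (dAt h₁.differentiable_ω p hp) (dAt h₂.differentiable_ω p hp), h₁.dz_ω hp,
        h₂.dz_ω hp, hf p hp, hGρ p hp, sub_self])
    (fun p hp => by
      rw [dρ_sub (dAt h₁.differentiable_ω p hp) (dAt h₂.differentiable_ω p hp), h₁.dρ_ω hp,
        h₂.dρ_ω hp, hf p hp, hGz p hp, sub_self])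
  obtain ⟨c₂, hc₂⟩ := eqOn_const_of_dz_of_dρ h₁.isOpen h₁.isConnected.isPreconnected
    (h₁.differentiable_γ.fun_sub h₂.differentiable_γ)
    (fun p hp => by
      rw [dz_sub (dAt h₁.differentiable_γ p hp) (dAt h₂.differentiable_γ p hp), sub_eq_zero,
        ← Complex.ofReal_inj, h₁.γ_z p hp, h₂.γ_z p hp, hf p hp, hGz p hp, hGρ p hp,
        dz_congr (eΦ p hp), dρ_congr (eΦ p hp)])
    (fun p hp => by
      rw [dρ_sub (dAt h₁.differentiable_γ p hp) (dAt h₂.differentiable_γ p hp), sub_eq_zero,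
        ← Complex.ofReal_inj, h₁.γ_ρ p hp, h₂.γ_ρ p hp, hf p hp, hGz p hp, hGρ p hp,
        dz_congr (eΦ p hp), dρ_congr (eΦ p hp)])
  exact ⟨c₁, c₂, fun p hp => ⟨by linarith [hc₁ p hp], by linarith [hc₂ p hp]⟩⟩

end IsElectrovacSolution

end

/-! ### Fixing the constants, and both directions of the equivalences -/

section

theorem isometry_reflect (z₀ : ℝ) : Isometry (reflect z₀) :=
  Isometry.of_dist_eq fun p q => by
    simp only [reflect, Prod.dist_eq, dist_sub_left]

theorem reflect_eq_self {z₀ : ℝ} {p : ℝ × ℝ} (h : p.1 = z₀) : reflect z₀ p = p := by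
  ext
  · simp only [reflect]; linarith
  · rfl

/-- A point and its mirror image lie on opposite sides of the plane, so connectedness gives a point
of D on it. -/
theorem exists_mem_fst_eq {D : Set (ℝ × ℝ)} (hD : IsConnected D) {z₀ : ℝ}
    (hR : ∀ p ∈ D, reflect z₀ p ∈ D) : ∃ p ∈ D, p.1 = z₀ := by
  obtain ⟨p, hp⟩ := hD.nonempty
  have hc : ContinuousOn (fun q : ℝ × ℝ => q.1) D := continuous_fst.continuousOn
  rcases le_total p.1 z₀ with h | h
  · obtain ⟨q, hq, hqz⟩ := hD.isPreconnected.intermediate_value hp (hR p hp) hc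
      ⟨h, show z₀ ≤ 2 * z₀ - p.1 by linarith⟩
    exact ⟨q, hq, hqz⟩
  · obtain ⟨q, hq, hqz⟩ := hD.isPreconnected.intermediate_value (hR p hp) hp hc
      ⟨show 2 * z₀ - p.1 ≤ z₀ by linarith, h⟩
    exact ⟨q, hq, hqz⟩

theorem mul_conj_exp_two_mul_I (δ : ℝ) :
    Complex.exp (2 * Complex.I * δ) * conj (Complex.exp (2 * Complex.I * δ)) = 1 := by
  rw [← Complex.exp_conj, ← Complex.exp_add]
  simp [map_ofNat]

theorem exists_eq_exp_two_mul_I {u : ℂ} (hu : u * conj u = 1) :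
    ∃ δ : ℝ, u = Complex.exp (2 * Complex.I * δ) := by
  have hn : ‖u‖ = 1 := by
    rw [Complex.mul_conj, Complex.normSq_eq_norm_sq] at hu
    exact (pow_eq_one_iff_of_nonneg (norm_nonneg u) two_ne_zero).1 (by exact_mod_cast hu)
  refine ⟨u.arg / 2, ?_⟩
  have := Complex.norm_mul_exp_arg_mul_I u
  rw [hn, Complex.ofReal_one, one_mul] at this
  rw [← this]
  congr 1
  rw [this]
  push_cast
  ring

variable {D : Set (ℝ × ℝ)} {E Φ : ℝ × ℝ → ℂ} {ω γ : ℝ × ℝ → ℝ} {z₀ : ℝ}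

/-- Both normalizations become limits along a single proper filter on D preserved by the reflection:
the pure filter at a fixed point, or the filter at infinity. -/
theorem NormalizedAt.exists_filter (hn : NormalizedAt D E Φ z₀) (hR : ∀ p ∈ D, reflect z₀ p ∈ D) :
    ∃ l : Filter (ℝ × ℝ), l.NeBot ∧ (∀ᶠ p in l, p ∈ D) ∧ Tendsto Φ l (𝓝 0) ∧
      Tendsto (fun p => (E p).im) l (𝓝 0) ∧ Tendsto (reflect z₀) l l := by
  rcases hn with ⟨p, hp, hpz, hΦ, hE⟩ | ⟨hb, hΦ, hE⟩
  · refine ⟨pure p, inferInstance, hp, ?_, ?_, ?_⟩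
    · rw [← hΦ]; exact tendsto_pure_nhds Φ p
    · rw [← hE]; exact tendsto_pure_nhds (fun p => (E p).im) p
    · rw [tendsto_pure_left]
      intro s hs
      rw [reflect_eq_self hpz]
      exact hs
  · refine ⟨_, ⟨fun h => hb ?_⟩, mem_inf_of_right (mem_principal_self D), hΦ, hE, ?_⟩
    · rw [Bornology.isBounded_def]
      exact inf_principal_eq_bot.1 h
    · exact (isometry_reflect z₀).antilipschitz.tendsto_cobounded.inf
        (tendsto_principal_principal.2 hR)

/-- The reflected and the conjugated solution share f, -ω and γ, so they differ by a phase and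
constants a, b; limits along the filter show that both constants are zero. -/
theorem potentialsSymmetricAt_of_normalizedAt (h : IsElectrovacSolution D E Φ ω γ)
    (hn : NormalizedAt D E Φ z₀) (hs : EquatoriallySymmetricAt D (metricF E Φ) ω γ z₀) :
    PotentialsSymmetricAt D E Φ z₀ := by
  have hR : ∀ p ∈ D, reflect z₀ p ∈ D := fun p hp => (hs p hp).1
  obtain ⟨u, a, b, hu, hab⟩ := (h.comp_reflect hR).exists_gauge_of_same_metric h.conjugate
    (fun p hp => (hs p hp).2.1.trans (by simp [metricF])) (c₁ := 0) (c₂ := 0)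
    (fun p hp => by rw [(hs p hp).2.2.1, add_zero]) (fun p hp => by rw [(hs p hp).2.2.2, add_zero])
  obtain ⟨l, hl, hlD, hΦ, hE, hlR⟩ := hn.exists_filter hR
  have ha : a = 0 := by
    have h1 : Tendsto (fun p => Φ (reflect z₀ p) - u * conj (Φ p)) l (𝓝 (0 - u * conj 0)) :=
      (hΦ.comp hlR).sub (((Complex.continuous_conj.tendsto 0).comp hΦ).const_mul u)
    have h2 : Tendsto (fun p => Φ (reflect z₀ p) - u * conj (Φ p)) l (𝓝 a) :=
      tendsto_const_nhds.congr' (by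
        filter_upwards [hlD] with p hp
        rw [(hab p hp).1]; ring)
    simpa using tendsto_nhds_unique h2 h1
  subst ha
  have hb : b = 0 := by
    have h1 : Tendsto (fun p => (E (reflect z₀ p)).im + (E p).im) l (𝓝 (0 + 0)) :=
      (hE.comp hlR).add hE
    have h2 : Tendsto (fun p => (E (reflect z₀ p)).im + (E p).im) l (𝓝 b) :=
      tendsto_const_nhds.congr' (by
        filter_upwards [hlD] with p hp
        rw [(hab p hp).2]; simp [gaugeE])
    simpa using tendsto_nhds_unique h2 h1
  subst hb
  obtain ⟨δ, rfl⟩ := exists_eq_exp_two_mul_I hu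
  refine ⟨δ, fun p hp => ⟨hR p hp, ?_, ?_⟩⟩
  · rw [(hab p hp).2]; simp [gaugeE]
  · rw [(hab p hp).1, add_zero]

theorem potentialsAntisymmetricAt_of_normalizedAt (h : IsElectrovacSolution D E Φ ω γ)
    (hn : NormalizedAt D E Φ z₀) (hs : EquatoriallyAntisymmetricAt D (metricF E Φ) ω γ z₀) :
    PotentialsAntisymmetricAt D E Φ z₀ := by
  obtain ⟨ω₀, hs⟩ := hs
  have hR : ∀ p ∈ D, reflect z₀ p ∈ D := fun p hp => (hs p hp).1
  -- Oddness of ω - ω₀ reads -ω∘R = ω - 2ω₀.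
  obtain ⟨u, a, b, hu, hab⟩ := (h.comp_reflect hR).exists_gauge_of_same_metric h
    (fun p hp => (hs p hp).2.1) (c₁ := -(2 * ω₀)) (c₂ := 0)
    (fun p hp => by linarith [(hs p hp).2.2.1]) (fun p hp => by rw [(hs p hp).2.2.2, add_zero])
  obtain ⟨l, hl, hlD, hΦ, hE, hlR⟩ := hn.exists_filter hR
  have ha : a = 0 := by
    have h1 : Tendsto (fun p => Φ (reflect z₀ p) - u * Φ p) l (𝓝 (0 - u * 0)) :=
      (hΦ.comp hlR).sub (hΦ.const_mul u)
    have h2 : Tendsto (fun p => Φ (reflect z₀ p) - u * Φ p) l (𝓝 a) :=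
      tendsto_const_nhds.congr' (by
        filter_upwards [hlD] with p hp
        rw [(hab p hp).1]; ring)
    simpa using tendsto_nhds_unique h2 h1
  subst ha
  have hb : b = 0 := by
    have h1 : Tendsto (fun p => (E (reflect z₀ p)).im - (E p).im) l (𝓝 (0 - 0)) :=
      (hE.comp hlR).sub hE
    have h2 : Tendsto (fun p => (E (reflect z₀ p)).im - (E p).im) l (𝓝 b) :=
      tendsto_const_nhds.congr' (by
        filter_upwards [hlD] with p hp
        rw [(hab p hp).2]; simp [gaugeE])
    simpa using tendsto_nhds_unique h2 h1
  subst hb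
  have hE' : ∀ p ∈ D, E (reflect z₀ p) = E p := fun p hp => by
    rw [(hab p hp).2]; simp [gaugeE]
  have hΦ' : ∀ p ∈ D, Φ (reflect z₀ p) = u * Φ p := fun p hp => by
    rw [(hab p hp).1, add_zero]
  -- If Φ vanishes identically, u is undetermined and the sign +1 is chosen; otherwise reflecting
  -- twice at a point with Φ ≠ 0 gives u² = 1.
  by_cases h0 : ∀ p ∈ D, Φ p = 0
  · exact ⟨1, Or.inl rfl, fun p hp => ⟨hR p hp, hE' p hp, by rw [h0 p hp, h0 _ (hR p hp), mul_zero]⟩⟩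
  · push Not at h0
    obtain ⟨q, hq, hq0⟩ := h0
    refine ⟨u, sq_eq_one_iff.1 ?_, fun p hp => ⟨hR p hp, hE' p hp, hΦ' p hp⟩⟩
    have := hΦ' _ (hR q hq)
    rw [reflect_reflect, hΦ' q hq] at this
    refine mul_right_cancel₀ hq0 ?_
    linear_combination -this

theorem equatoriallySymmetricAt_of_potentials (h : IsElectrovacSolution D E Φ ω γ)
    (hs : PotentialsSymmetricAt D E Φ z₀) :
    EquatoriallySymmetricAt D (metricF E Φ) ω γ z₀ := by
  obtain ⟨δ, hs⟩ := hs
  have hR : ∀ p ∈ D, reflect z₀ p ∈ D := fun p hp => (hs p hp).1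
  have hu := mul_conj_exp_two_mul_I δ
  obtain ⟨c₁, c₂, hc⟩ := (h.comp_reflect hR).exists_const_of_eqOn (h.conjugate.phase hu)
    (fun p hp => (hs p hp).2.1) (fun p hp => (hs p hp).2.2)
  -- At a fixed point of the reflection both constants are seen to be zero.
  obtain ⟨q, hq, hqz⟩ := exists_mem_fst_eq h.isConnected hR
  obtain ⟨k₁, k₂⟩ := hc q hq
  rw [reflect_eq_self hqz] at k₁ k₂
  refine fun p hp => ⟨hR p hp, ?_, by linarith [(hc p hp).1], by linarith [(hc p hp).2]⟩
  have e := metricF_phase (fun p => conj (E p)) (fun p => conj (Φ p)) hu p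
  rw [metricF, metricF] at e
  rw [metricF, (hs p hp).2.1, (hs p hp).2.2, e]
  simp [metricF]

theorem equatoriallyAntisymmetricAt_of_potentials (h : IsElectrovacSolution D E Φ ω γ)
    (hs : PotentialsAntisymmetricAt D E Φ z₀) :
    EquatoriallyAntisymmetricAt D (metricF E Φ) ω γ z₀ := by
  obtain ⟨ε, hε, hs⟩ := hs
  have hR : ∀ p ∈ D, reflect z₀ p ∈ D := fun p hp => (hs p hp).1
  have hu : ε * conj ε = 1 := by rcases hε with rfl | rfl <;> simp
  obtain ⟨c₁, c₂, hc⟩ := (h.comp_reflect hR).exists_const_of_eqOn (h.phase hu)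
    (fun p hp => (hs p hp).2.1) (fun p hp => (hs p hp).2.2)
  obtain ⟨q, hq, hqz⟩ := exists_mem_fst_eq h.isConnected hR
  have k₂ := (hc q hq).2
  rw [reflect_eq_self hqz] at k₂
  -- Here -ω∘R = ω + c₁, so ω is odd about -c₁/2; only the constant of γ has to vanish.
  refine ⟨-c₁ / 2, fun p hp => ⟨hR p hp, ?_, by linarith [(hc p hp).1], by linarith [(hc p hp).2]⟩⟩
  rw [metricF, (hs p hp).2.1, (hs p hp).2.2]
  exact metricF_phase E Φ hu p

/-- A reflection-invariant connected D meets the plane, so the constants can be fixed there; this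
reduces the first two equivalences to normalized potentials. -/
theorem exists_gauge_normalizedAt (hD : IsConnected D) (hR : ∀ p ∈ D, reflect z₀ p ∈ D) :
    ∃ (a : ℂ) (b : ℝ), NormalizedAt D (gaugeE a b E Φ) (gaugeΦ a Φ) z₀ := by
  obtain ⟨q, hq, hqz⟩ := exists_mem_fst_eq hD hR
  refine ⟨-Φ q, -(gaugeE (-Φ q) 0 E Φ q).im, Or.inl ⟨q, hq, hqz, ?_, ?_⟩⟩
  · simp [gaugeΦ]
  · simp only [gaugeE, Complex.add_im, Complex.ofReal_zero, Complex.im_ofReal_mul, Complex.I_im]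
    simp

theorem metricF_gauge_eq (E Φ : ℝ × ℝ → ℂ) (a : ℂ) (b : ℝ) :
    metricF (gaugeE a b E Φ) (gaugeΦ a Φ) = metricF E Φ :=
  funext (metricF_gauge E Φ a b)

end

end Ernst

end

theorem theorem1 (D : Set (ℝ × ℝ)) (E Φ : ℝ × ℝ → ℂ) (ω γ : ℝ × ℝ → ℝ)
    (h : Ernst.IsElectrovacSolution D E Φ ω γ) (z₀ : ℝ) :
    (Ernst.EquatoriallySymmetricAt D (Ernst.metricF E Φ) ω γ z₀ ↔
      ∃ (a : ℂ) (b : ℝ),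
        Ernst.PotentialsSymmetricAt D (Ernst.gaugeE a b E Φ) (Ernst.gaugeΦ a Φ) z₀) ∧
    (Ernst.EquatoriallyAntisymmetricAt D (Ernst.metricF E Φ) ω γ z₀ ↔
      ∃ (a : ℂ) (b : ℝ),
        Ernst.PotentialsAntisymmetricAt D (Ernst.gaugeE a b E Φ) (Ernst.gaugeΦ a Φ) z₀) ∧
    (Ernst.NormalizedAt D E Φ z₀ →
      (Ernst.EquatoriallySymmetricAt D (Ernst.metricF E Φ) ω γ z₀ ↔
        Ernst.PotentialsSymmetricAt D E Φ z₀) ∧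
      (Ernst.EquatoriallyAntisymmetricAt D (Ernst.metricF E Φ) ω γ z₀ ↔
        Ernst.PotentialsAntisymmetricAt D E Φ z₀)) := by
  refine ⟨⟨fun hs => ?_, fun ⟨a, b, hs⟩ => ?_⟩, ⟨fun hs => ?_, fun ⟨a, b, hs⟩ => ?_⟩, fun hn =>
    ⟨⟨Ernst.potentialsSymmetricAt_of_normalizedAt h hn,
      Ernst.equatoriallySymmetricAt_of_potentials h⟩,
    ⟨Ernst.potentialsAntisymmetricAt_of_normalizedAt h hn,
      Ernst.equatoriallyAntisymmetricAt_of_potentials h⟩⟩⟩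
  · obtain ⟨a, b, hn⟩ := Ernst.exists_gauge_normalizedAt (E := E) (Φ := Φ) h.isConnected
      fun p hp => (hs p hp).1
    refine ⟨a, b, Ernst.potentialsSymmetricAt_of_normalizedAt (h.gauge a b) hn ?_⟩
    rwa [Ernst.metricF_gauge_eq]
  · rw [← Ernst.metricF_gauge_eq E Φ a b]
    exact Ernst.equatoriallySymmetricAt_of_potentials (h.gauge a b) hs
  · obtain ⟨a, b, hn⟩ := Ernst.exists_gauge_normalizedAt (E := E) (Φ := Φ) h.isConnected
      fun p hp => (hs.choose_spec p hp).1
    refine ⟨a, b, Ernst.potentialsAntisymmetricAt_of_normalizedAt (h.gauge a b) hn ?_⟩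
    rwa [Ernst.metricF_gauge_eq]
  · rw [← Ernst.metricF_gauge_eq E Φ a b]
    exact Ernst.equatoriallyAntisymmetricAt_of_potentials (h.gauge a b) hs
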